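/- **Theorem.** Work with locales and sup-lattices (complete lattices with sup-preserving maps). For locales $X,Y$, an $(X,Y)$-bimodule $A\colon X\to Y$ is a sup-lattice $A$ with a unital associative left action of $(X,\wedge,\top)$ and a unital associative right action of $(Y,\wedge,\top)$, each preserving suprema in each variable, with $x(ay)=(xa)y$; a bimodule homomorphism is a sup-preserving map commuting with both actions. The opposite lattice $A^\circ$ is a $(Y,X)$-bimodule: $x\in X$ acts on the right by the right adjoint $a\mapsto a/x$ of $x\cdot-$, and $y\in Y$ acts on the left by the right adjoint $a\mapsto y\backslash a$ of $-\cdot y$. For $A\colon X\to Y$ and $B\colon Y\to Z$ put $$A\otimes B=A\otimes_Y B,\qquad A\oplus B=(B^\circ\otimes A^\circ)^\circ ,$$ where $\otimes_Y$ is the tensor product of sup-lattices over $Y$. The composition $\otimes$ has identity 1-cells $X$ with the usual associativity and unit isomorphisms; the composition $\oplus$ has identity 1-cells $X^\circ$ and the associativity and unit isomorphisms induced by those of $\otimes$ and by $(A^\circ)^\circ\cong A$. Let ${\rm Mod}Y(-,-)$ and $Z{\rm Mod}(-,-)$ denote the bimodules of right $Y$-module and of left $Z$-module homomorphisms. Using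 the isomorphisms $A\oplus B\cong Y{\rm Mod}(A^\circ,B)\cong {\rm Mod}Y(B^\circ,A)$ and $(A\otimes B)^\circ\cong {\rm Mod}Y(A,B^\circ)\cong Y{\rm Mod}(B,A^\circ)$, let, for $C\colon Z\to W$, $$\delta^L\colon A\otimes(B\oplus C)\to(A\otimes B)\oplus C,\qquad \delta^R\colon (A\oplus B)\otimes C\to A\oplus(B\otimes C)$$ be the homomorphisms corresponding to $$A\otimes Z{\rm Mod}(B^\circ,C)\to Z{\rm Mod}({\rm Mod}Y(A,B^\circ),C),\quad a\otimes g\mapsto (h\mapsto g(h(a))),$$ $${\rm Mod}Y(B^\circ,A)\otimes C\to {\rm Mod}Y(Z{\rm Mod}(C,B^\circ),A),\quad f\otimes c\mapsto (h\mapsto f(h(c))),$$ that is, to the transposes of evaluation maps. Then locales (0-cells), bimodules (1-cells) and bimodule homomorphisms (2-cells), with $\otimes$, $\oplus$, $\delta^L$ and $\delta^R$, form a linear bicategory in the sense of Cockett, Koslowski and Seely: $\otimes$ and $\oplus$ are both bicategory structures on these 0-, 1- and 2-cells, $\delta^L$ and $\delta^R$ are natural in all three variables, and they satisfy the coherence conditions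 of (non-symmetric) linear distributivity, namely the four conditions with the units of $\otimes$ and $\oplus$, the four conditions with the associativities of $\otimes$ and $\oplus$, and the two conditions relating $\delta^L$ and $\delta^R$ (on $A\otimes(B\oplus C)\otimes D$ and on $(A\oplus B)\otimes(C\oplus D)$). This linear bicategory is not locally posetal: there are bimodules $A,B\colon X\to Y$ with two distinct bimodule homomorphisms $A\to B$. -/

import Mathlib

open CategoryTheory

set_option linter.unusedVariables false

universe u v w t

/-! ## Bicategories and linear bicategories: data and axioms -/

/-- The data of a bicategory with 0-cells `O` and with given categories `H X Y` of 1-cells and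
2-cells (no axioms yet). Composition of 1-cells is written in diagrammatic order. -/
structure BicategoryData (O : Type u) (H : O → O → Type v) [∀ X Y, Category.{w} (H X Y)] where
  /-- composition of 1-cells -/
  comp {X Y Z : O} : H X Y → H Y Z → H X Z
  /-- identity 1-cells -/
  unit (X : O) : H X X
  /-- action of composition on a 2-cell in the second variable -/
  whiskerLeft {X Y Z : O} (A : H X Y) {B B' : H Y Z} (g : B ⟶ B') : comp A B ⟶ comp A B'
  /-- action of composition on a 2-cell in the first variable -/
  whiskerRight {X Y Z : O} {A A' : H X Y} (f : A ⟶ A') (B : H Y Z) : comp A B ⟶ comp A' B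
  /-- associator -/
  assoc {X Y Z W : O} (A : H X Y) (B : H Y Z) (C : H Z W) :
    comp (comp A B) C ≅ comp A (comp B C)
  /-- left unitor -/
  leftUnitor {X Y : O} (A : H X Y) : comp (unit X) A ≅ A
  /-- right unitor -/
  rightUnitor {X Y : O} (A : H X Y) : comp A (unit Y) ≅ A

/-- The bicategory axioms (those of `CategoryTheory.Bicategory`). -/
structure BicategoryData.IsBicategory {O : Type u} {H : O → O → Type v}
    [∀ X Y, Category.{w} (H X Y)] (D : BicategoryData O H) : Prop where
  whiskerLeft_id : ∀ {X Y Z : O} (A : H X Y) (B : H Y Z),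
    D.whiskerLeft A (𝟙 B) = 𝟙 (D.comp A B)
  whiskerLeft_comp : ∀ {X Y Z : O} (A : H X Y) {B B' B'' : H Y Z} (f : B ⟶ B') (g : B' ⟶ B''),
    D.whiskerLeft A (f ≫ g) = D.whiskerLeft A f ≫ D.whiskerLeft A g
  id_whiskerLeft : ∀ {X Y : O} {A A' : H X Y} (f : A ⟶ A'),
    D.whiskerLeft (D.unit X) f = (D.leftUnitor A).hom ≫ f ≫ (D.leftUnitor A').inv
  comp_whiskerLeft : ∀ {X Y Z W : O} (A : H X Y) (B : H Y Z) {C C' : H Z W} (f : C ⟶ C'),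
    D.whiskerLeft (D.comp A B) f =
      (D.assoc A B C).hom ≫ D.whiskerLeft A (D.whiskerLeft B f) ≫ (D.assoc A B C').inv
  id_whiskerRight : ∀ {X Y Z : O} (A : H X Y) (B : H Y Z),
    D.whiskerRight (𝟙 A) B = 𝟙 (D.comp A B)
  comp_whiskerRight : ∀ {X Y Z : O} {A A' A'' : H X Y} (f : A ⟶ A') (g : A' ⟶ A'') (B : H Y Z),
    D.whiskerRight (f ≫ g) B = D.whiskerRight f B ≫ D.whiskerRight g B
  whiskerRight_id : ∀ {X Y : O} {A A' : H X Y} (f : A ⟶ A'),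
    D.whiskerRight f (D.unit Y) = (D.rightUnitor A).hom ≫ f ≫ (D.rightUnitor A').inv
  whiskerRight_comp : ∀ {X Y Z W : O} {A A' : H X Y} (f : A ⟶ A') (B : H Y Z) (C : H Z W),
    D.whiskerRight f (D.comp B C) =
      (D.assoc A B C).inv ≫ D.whiskerRight (D.whiskerRight f B) C ≫ (D.assoc A' B C).hom
  whisker_assoc : ∀ {X Y Z W : O} (A : H X Y) {B B' : H Y Z} (f : B ⟶ B') (C : H Z W),
    D.whiskerRight (D.whiskerLeft A f) C =
      (D.assoc A B C).hom ≫ D.whiskerLeft A (D.whiskerRight f C) ≫ (D.assoc A B' C).inv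
  whisker_exchange : ∀ {X Y Z : O} {A A' : H X Y} {B B' : H Y Z} (f : A ⟶ A') (g : B ⟶ B'),
    D.whiskerLeft A g ≫ D.whiskerRight f B' = D.whiskerRight f B ≫ D.whiskerLeft A' g
  pentagon : ∀ {X Y Z W V : O} (A : H X Y) (B : H Y Z) (C : H Z W) (E : H W V),
    D.whiskerRight (D.assoc A B C).hom E ≫ (D.assoc A (D.comp B C) E).hom ≫
        D.whiskerLeft A (D.assoc B C E).hom =
      (D.assoc (D.comp A B) C E).hom ≫ (D.assoc A B (D.comp C E)).hom
  triangle : ∀ {X Y Z : O} (A : H X Y) (B : H Y Z),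
    (D.assoc A (D.unit Y) B).hom ≫ D.whiskerLeft A (D.leftUnitor B).hom =
      D.whiskerRight (D.rightUnitor A).hom B

/-- Bicategory data satisfying the axioms is the same thing as a Mathlib bicategory. -/
abbrev BicategoryData.IsBicategory.toBicategory {O : Type u} {H : O → O → Type v}
    [∀ X Y, Category.{w} (H X Y)] {D : BicategoryData O H} (h : D.IsBicategory) :
    Bicategory.{w, v} O where
  Hom := H
  id := D.unit
  comp := D.comp
  homCategory X Y := inferInstanceAs (Category (H X Y))
  whiskerLeft := D.whiskerLeft
  whiskerRight := D.whiskerRight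
  associator := D.assoc
  leftUnitor := D.leftUnitor
  rightUnitor := D.rightUnitor
  whiskerLeft_id := h.whiskerLeft_id
  whiskerLeft_comp := h.whiskerLeft_comp
  id_whiskerLeft := h.id_whiskerLeft
  comp_whiskerLeft := h.comp_whiskerLeft
  id_whiskerRight := h.id_whiskerRight
  comp_whiskerRight := h.comp_whiskerRight
  whiskerRight_id := h.whiskerRight_id
  whiskerRight_comp := h.whiskerRight_comp
  whisker_assoc := h.whisker_assoc
  whisker_exchange := h.whisker_exchange
  pentagon := h.pentagon
  triangle := h.triangle

/-- The data of a linear bicategory: two bicategory structures `⊗` (`tensor`, with units `⊤`) and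
`⊕` (`par`, with units `⊥`) on the same 0-cells, 1-cells and 2-cells (with the same vertical
composition), and the two linear distributions. -/
structure LinearBicategoryData (O : Type u) (H : O → O → Type v)
    [∀ X Y, Category.{w} (H X Y)] where
  /-- the first composition -/
  tensor : BicategoryData O H
  /-- the second composition -/
  par : BicategoryData O H
  /-- `A ⊗ (B ⊕ C) ⟶ (A ⊗ B) ⊕ C` -/
  distL {X Y Z W : O} (A : H X Y) (B : H Y Z) (C : H Z W) :
    tensor.comp A (par.comp B C) ⟶ par.comp (tensor.comp A B) C
  /-- `(A ⊕ B) ⊗ C ⟶ A ⊕ (B ⊗ C)` -/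
  distR {X Y Z W : O} (A : H X Y) (B : H Y Z) (C : H Z W) :
    tensor.comp (par.comp A B) C ⟶ par.comp A (tensor.comp B C)

/-- The axioms of a linear bicategory (Cockett–Koslowski–Seely): both compositions are bicategory
structures, the linear distributions are natural in all three variables, and they satisfy the
coherence conditions of (non-symmetric) linear distributivity. -/
structure LinearBicategoryData.IsLinearBicategory {O : Type u} {H : O → O → Type v}
    [∀ X Y, Category.{w} (H X Y)] (L : LinearBicategoryData O H) : Prop where
  tensor_isBicategory : L.tensor.IsBicategory
  par_isBicategory : L.par.IsBicategory
  -- naturality of the distributions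
  distL_natural₁ : ∀ {X Y Z W : O} {A A' : H X Y} (f : A ⟶ A') (B : H Y Z) (C : H Z W),
    L.tensor.whiskerRight f (L.par.comp B C) ≫ L.distL A' B C =
      L.distL A B C ≫ L.par.whiskerRight (L.tensor.whiskerRight f B) C
  distL_natural₂ : ∀ {X Y Z W : O} (A : H X Y) {B B' : H Y Z} (f : B ⟶ B') (C : H Z W),
    L.tensor.whiskerLeft A (L.par.whiskerRight f C) ≫ L.distL A B' C =
      L.distL A B C ≫ L.par.whiskerRight (L.tensor.whiskerLeft A f) C
  distL_natural₃ : ∀ {X Y Z W : O} (A : H X Y) (B : H Y Z) {C C' : H Z W} (f : C ⟶ C'),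
    L.tensor.whiskerLeft A (L.par.whiskerLeft B f) ≫ L.distL A B C' =
      L.distL A B C ≫ L.par.whiskerLeft (L.tensor.comp A B) f
  distR_natural₁ : ∀ {X Y Z W : O} {A A' : H X Y} (f : A ⟶ A') (B : H Y Z) (C : H Z W),
    L.tensor.whiskerRight (L.par.whiskerRight f B) C ≫ L.distR A' B C =
      L.distR A B C ≫ L.par.whiskerRight f (L.tensor.comp B C)
  distR_natural₂ : ∀ {X Y Z W : O} (A : H X Y) {B B' : H Y Z} (f : B ⟶ B') (C : H Z W),
    L.tensor.whiskerRight (L.par.whiskerLeft A f) C ≫ L.distR A B' C =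
      L.distR A B C ≫ L.par.whiskerLeft A (L.tensor.whiskerRight f C)
  distR_natural₃ : ∀ {X Y Z W : O} (A : H X Y) (B : H Y Z) {C C' : H Z W} (f : C ⟶ C'),
    L.tensor.whiskerLeft (L.par.comp A B) f ≫ L.distR A B C' =
      L.distR A B C ≫ L.par.whiskerLeft A (L.tensor.whiskerLeft B f)
  -- distributions and units
  distL_top : ∀ {X Y Z : O} (A : H X Y) (B : H Y Z),
    L.distL (L.tensor.unit X) A B ≫ L.par.whiskerRight (L.tensor.leftUnitor A).hom B =
      (L.tensor.leftUnitor (L.par.comp A B)).hom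
  distL_bot : ∀ {X Y Z : O} (A : H X Y) (B : H Y Z),
    L.distL A B (L.par.unit Z) ≫ (L.par.rightUnitor (L.tensor.comp A B)).hom =
      L.tensor.whiskerLeft A (L.par.rightUnitor B).hom
  distR_top : ∀ {X Y Z : O} (A : H X Y) (B : H Y Z),
    L.distR A B (L.tensor.unit Z) ≫ L.par.whiskerLeft A (L.tensor.rightUnitor B).hom =
      (L.tensor.rightUnitor (L.par.comp A B)).hom
  distR_bot : ∀ {X Y Z : O} (A : H X Y) (B : H Y Z),
    L.distR (L.par.unit X) A B ≫ (L.par.leftUnitor (L.tensor.comp A B)).hom =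
      L.tensor.whiskerRight (L.par.leftUnitor A).hom B
  -- distributions and associativity of `⊗`
  distL_tensor_assoc : ∀ {X Y Z W V : O} (A : H X Y) (B : H Y Z) (C : H Z W) (E : H W V),
    L.distL (L.tensor.comp A B) C E ≫ L.par.whiskerRight (L.tensor.assoc A B C).hom E =
      (L.tensor.assoc A B (L.par.comp C E)).hom ≫ L.tensor.whiskerLeft A (L.distL B C E) ≫
        L.distL A (L.tensor.comp B C) E
  distR_tensor_assoc : ∀ {X Y Z W V : O} (A : H X Y) (B : H Y Z) (C : H Z W) (E : H W V),
    (L.tensor.assoc (L.par.comp A B) C E).hom ≫ L.distR A B (L.tensor.comp C E) =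
      L.tensor.whiskerRight (L.distR A B C) E ≫ L.distR A (L.tensor.comp B C) E ≫
        L.par.whiskerLeft A (L.tensor.assoc B C E).hom
  -- distributions and associativity of `⊕`
  distL_par_assoc : ∀ {X Y Z W V : O} (A : H X Y) (B : H Y Z) (C : H Z W) (E : H W V),
    L.tensor.whiskerLeft A (L.par.assoc B C E).hom ≫ L.distL A B (L.par.comp C E) =
      L.distL A (L.par.comp B C) E ≫ L.par.whiskerRight (L.distL A B C) E ≫
        (L.par.assoc (L.tensor.comp A B) C E).hom
  distR_par_assoc : ∀ {X Y Z W V : O} (A : H X Y) (B : H Y Z) (C : H Z W) (E : H W V),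
    L.distR (L.par.comp A B) C E ≫ (L.par.assoc A B (L.tensor.comp C E)).hom =
      L.tensor.whiskerRight (L.par.assoc A B C).hom E ≫ L.distR A (L.par.comp B C) E ≫
        L.par.whiskerLeft A (L.distR B C E)
  -- compatibility of the two distributions
  distL_distR : ∀ {X Y Z W V : O} (A : H X Y) (B : H Y Z) (C : H Z W) (E : H W V),
    L.tensor.whiskerRight (L.distL A B C) E ≫ L.distR (L.tensor.comp A B) C E =
      (L.tensor.assoc A (L.par.comp B C) E).hom ≫ L.tensor.whiskerLeft A (L.distR B C E) ≫
        L.distL A B (L.tensor.comp C E)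
  distR_distL : ∀ {X Y Z W V : O} (A : H X Y) (B : H Y Z) (C : H Z W) (E : H W V),
    L.distL (L.par.comp A B) C E ≫ L.par.whiskerRight (L.distR A B C) E ≫
        (L.par.assoc A (L.tensor.comp B C) E).hom =
      L.distR A B (L.par.comp C E) ≫ L.par.whiskerLeft A (L.distL B C E)

/-! ## Sup-preserving maps -/

/-- `f` preserves arbitrary suprema. -/
def SupPres {α : Type u} {β : Type v} [CompleteLattice α] [CompleteLattice β] (f : α → β) : Prop :=
  ∀ S : Set α, f (sSup S) = sSup (f '' S)

/-- The right adjoint of a sup-preserving map. -/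
def radj {α : Type u} {β : Type v} [CompleteLattice α] [CompleteLattice β] (f : α → β) (b : β) : α :=
  sSup {a | f a ≤ b}

namespace SupPres

variable {α : Type u} {β : Type v} {γ : Type w} [CompleteLattice α] [CompleteLattice β]
  [CompleteLattice γ]

theorem of_gc {f : α → β} {g : β → α} (h : GaloisConnection f g) : SupPres f := fun S => by
  rw [h.l_sSup, sSup_image]

theorem apply_le {f : α → β} (h : SupPres f) (S : Set α) (b : β) :
    f (sSup S) ≤ b ↔ ∀ a ∈ S, f a ≤ b := by
  rw [h S, sSup_le_iff, Set.forall_mem_image]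

theorem of_apply_le {f : α → β} (h : ∀ (S : Set α) (b : β), f (sSup S) ≤ b ↔ ∀ a ∈ S, f a ≤ b) :
    SupPres f := fun S => eq_of_forall_ge_iff fun b => by
  rw [h S, sSup_le_iff, Set.forall_mem_image]

theorem mono {f : α → β} (h : SupPres f) : Monotone f := fun a b hab => by
  have h1 := (h.apply_le {a, b} (f b)).1 (by rw [sSup_pair, sup_eq_right.2 hab])
  exact h1 a (by simp)

theorem gc {f : α → β} (h : SupPres f) : GaloisConnection f (radj f) := fun a b =>
  ⟨fun hab => le_sSup hab, fun hab => (h.mono hab).trans <| (h.apply_le _ _).2 fun _ ha' => ha'⟩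

theorem ident : SupPres (fun a : α => a) := fun S => by simp

theorem comp {f : β → γ} {g : α → β} (hf : SupPres f) (hg : SupPres g) :
    SupPres (fun a => f (g a)) := fun S => by
  show f (g _) = _
  rw [hg S, hf, Set.image_image]

/-- The right adjoint, seen as a map of opposite lattices, preserves suprema. -/
theorem radj_dual {f : α → β} (h : SupPres f) :
    SupPres (fun b : βᵒᵈ => OrderDual.toDual (radj f (OrderDual.ofDual b))) :=
  of_apply_le fun S a => by
    show OrderDual.ofDual a ≤ radj f (sInf (OrderDual.toDual ⁻¹' S)) ↔
      ∀ b ∈ S, OrderDual.ofDual a ≤ radj f (OrderDual.ofDual b)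
    rw [← h.gc.le_iff_le, le_sInf_iff]
    exact forall₂_congr fun b _ => h.gc.le_iff_le

theorem pointwise {ι : Type t} (p : ι → Prop) {F : ι → α → β} (h : ∀ i, SupPres (F i)) :
    SupPres (fun a => ⨆ i, ⨆ _ : p i, F i a) :=
  of_apply_le fun _ _ => by
    simp only [iSup_le_iff, (h _).apply_le]
    exact ⟨fun H a ha i hi => H i hi a ha, fun H i hi a ha => H a ha i hi⟩

end SupPres

/-! ## Bimodules over locales -/

/-- An `(X, Y)`-bimodule: a sup-lattice `A` with a unital associative left action of `X` and a
unital associative right action of `Y` (the multiplication of a locale is `⊓`, its unit is `⊤`),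
both preserving suprema in each variable, such that `x (a y) = (x a) y`. -/
structure LocBimod (X Y : Type u) [Order.Frame X] [Order.Frame Y] where
  /-- the underlying sup-lattice -/
  carrier : Type u
  [lat : CompleteLattice carrier]
  /-- the left action -/
  lact : X → carrier → carrier
  /-- the right action -/
  ract : carrier → Y → carrier
  lact_sup : ∀ x, SupPres (lact x)
  sup_lact : ∀ a, SupPres (fun x => lact x a)
  lact_top : ∀ a, lact ⊤ a = a
  lact_inf : ∀ x x' a, lact (x ⊓ x') a = lact x (lact x' a)
  ract_sup : ∀ a, SupPres (ract a)
  sup_ract : ∀ y, SupPres (fun a => ract a y)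
  ract_top : ∀ a, ract a ⊤ = a
  ract_inf : ∀ a y y', ract a (y ⊓ y') = ract (ract a y) y'
  lact_ract : ∀ x a y, lact x (ract a y) = ract (lact x a) y

namespace LocBimod

attribute [instance] LocBimod.lat

instance {X Y : Type u} [Order.Frame X] [Order.Frame Y] : CoeSort (LocBimod X Y) (Type u) :=
  ⟨LocBimod.carrier⟩

section

variable {X Y Z W : Type u} [Order.Frame X] [Order.Frame Y] [Order.Frame Z] [Order.Frame W]

/-- Bimodule homomorphisms: sup-preserving maps commuting with both actions. -/
@[ext]
structure Hom (A B : LocBimod X Y) where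
  /-- the underlying map -/
  toFun : A → B
  sup : SupPres toFun
  map_lact : ∀ x a, toFun (A.lact x a) = B.lact x (toFun a)
  map_ract : ∀ a y, toFun (A.ract a y) = B.ract (toFun a) y

instance : Category (LocBimod X Y) where
  Hom := Hom
  id A := ⟨fun a => a, SupPres.ident, fun _ _ => rfl, fun _ _ => rfl⟩
  comp f g := ⟨fun a => g.toFun (f.toFun a), g.sup.comp f.sup,
    fun x a => by rw [f.map_lact, g.map_lact], fun a y => by rw [f.map_ract, g.map_ract]⟩

theorem hom_ext {A B : LocBimod X Y} {f g : A ⟶ B} (h : ∀ a, f.toFun a = g.toFun a) : f = g :=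
  Hom.ext (funext h)

@[simp] theorem id_toFun (A : LocBimod X Y) (a : A) : Hom.toFun (𝟙 A) a = a := rfl

@[simp] theorem comp_toFun {A B C : LocBimod X Y} (f : A ⟶ B) (g : B ⟶ C) (a : A) :
    Hom.toFun (f ≫ g) a = g.toFun (f.toFun a) := rfl

/-- The locale `X` as an `(X, X)`-bimodule. -/
def unit (X : Type u) [Order.Frame X] : LocBimod X X where
  carrier := X
  lact x a := x ⊓ a
  ract a y := a ⊓ y
  lact_sup x := fun S => inf_sSup_eq.trans sSup_image.symm
  sup_lact a := fun S => sSup_inf_eq.trans sSup_image.symm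
  lact_top a := top_inf_eq a
  lact_inf x x' a := inf_assoc x x' a
  ract_sup a := fun S => inf_sSup_eq.trans sSup_image.symm
  sup_ract y := fun S => sSup_inf_eq.trans sSup_image.symm
  ract_top a := inf_top_eq a
  ract_inf a y y' := (inf_assoc a y y').symm
  lact_ract x a y := (inf_assoc x a y).symm

/-! ### The opposite bimodule -/

/-- `x ↦ a / x`: the right adjoint of the left action of `x`. -/
def lres (A : LocBimod X Y) (a : A) (x : X) : A := radj (A.lact x) a

/-- `y \ a`: the right adjoint of the right action of `y`. -/
def rres (A : LocBimod X Y) (y : Y) (a : A) : A := radj (fun a' => A.ract a' y) a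

theorem le_lres (A : LocBimod X Y) (a a' : A) (x : X) : a' ≤ A.lres a x ↔ A.lact x a' ≤ a :=
  ((A.lact_sup x).gc a' a).symm

theorem le_rres (A : LocBimod X Y) (a a' : A) (y : Y) : a' ≤ A.rres y a ↔ A.ract a' y ≤ a :=
  ((A.sup_ract y).gc a' a).symm

/-- The opposite lattice `A°` of an `(X, Y)`-bimodule, as a `(Y, X)`-bimodule. -/
def op (A : LocBimod X Y) : LocBimod Y X where
  carrier := (A.carrier)ᵒᵈ
  lact y a := OrderDual.toDual (A.rres y (OrderDual.ofDual a))
  ract a x := OrderDual.toDual (A.lres (OrderDual.ofDual a) x)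
  lact_sup y := (A.sup_ract y).radj_dual
  sup_lact a := SupPres.of_apply_le fun S b => by
    change OrderDual.ofDual b ≤ A.rres _ _ ↔ ∀ y ∈ S, OrderDual.ofDual b ≤ A.rres _ _
    simp only [le_rres, (A.ract_sup _).apply_le]
  lact_top a := congrArg OrderDual.toDual <| eq_of_forall_le_iff fun b => by
    rw [le_rres, A.ract_top]; rfl
  lact_inf y y' a := congrArg OrderDual.toDual <| eq_of_forall_le_iff fun b => by
    rw [le_rres, A.ract_inf]
    exact Iff.symm ((A.le_rres _ _ _).trans (A.le_rres _ _ _))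
  ract_sup a := SupPres.of_apply_le fun S b => by
    change OrderDual.ofDual b ≤ A.lres _ _ ↔ ∀ x ∈ S, OrderDual.ofDual b ≤ A.lres _ _
    simp only [le_lres, (A.sup_lact _).apply_le]
  sup_ract x := (A.lact_sup x).radj_dual
  ract_top a := congrArg OrderDual.toDual <| eq_of_forall_le_iff fun b => by
    rw [le_lres, A.lact_top]; rfl
  ract_inf a x x' := congrArg OrderDual.toDual <| eq_of_forall_le_iff fun b => by
    rw [le_lres, A.lact_inf]
    exact Iff.symm ((A.le_lres _ _ _).trans (A.le_lres _ _ _))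
  lact_ract y a x := congrArg OrderDual.toDual <| eq_of_forall_le_iff fun b => by
    refine ((A.le_rres _ _ _).trans (A.le_lres _ _ _)).trans
      (Iff.symm ((A.le_lres _ _ _).trans ((A.le_rres _ _ _).trans ?_)))
    rw [A.lact_ract]

/-- The right adjoint of a bimodule homomorphism. -/
def Hom.adj {A B : LocBimod X Y} (f : A ⟶ B) (b : B) : A := radj f.toFun b

theorem le_adj {A B : LocBimod X Y} (f : A ⟶ B) (a : A) (b : B) :
    a ≤ Hom.adj f b ↔ f.toFun a ≤ b := (f.sup.gc a b).symm

/-- The bimodule homomorphism `f° : B° ⟶ A°` given by the right adjoint of `f : A ⟶ B`. -/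
def opMap {A B : LocBimod X Y} (f : A ⟶ B) : B.op ⟶ A.op where
  toFun b := OrderDual.toDual (Hom.adj (A := A) (B := B) f (OrderDual.ofDual b))
  sup := f.sup.radj_dual
  map_lact y b := congrArg OrderDual.toDual <| eq_of_forall_le_iff (α := A) fun a => by
    refine ((le_adj f _ _).trans (B.le_rres _ _ _)).trans
      (Iff.symm ((A.le_rres _ _ _).trans ((le_adj f _ _).trans ?_)))
    rw [f.map_ract]
  map_ract b x := congrArg OrderDual.toDual <| eq_of_forall_le_iff (α := A) fun a => by
    refine ((le_adj f _ _).trans (B.le_lres _ _ _)).trans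
      (Iff.symm ((A.le_lres _ _ _).trans ((le_adj f _ _).trans ?_)))
    rw [f.map_lact]

theorem opMap_id (A : LocBimod X Y) : opMap (𝟙 A) = 𝟙 A.op := hom_ext fun b =>
  congrArg OrderDual.toDual <| eq_of_forall_le_iff (α := A) fun a => le_adj (𝟙 A) _ _

theorem opMap_comp {A B C : LocBimod X Y} (f : A ⟶ B) (g : B ⟶ C) :
    opMap (f ≫ g) = opMap g ≫ opMap f := hom_ext fun c =>
  congrArg OrderDual.toDual <| eq_of_forall_le_iff (α := A) fun a =>
    (le_adj (f ≫ g) _ _).trans (((le_adj f _ _).trans (le_adj g _ _)).symm)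

/-- An isomorphism `A ≅ B` induces `A° ≅ B°`. -/
def opIso {A B : LocBimod X Y} (i : A ≅ B) : A.op ≅ B.op where
  hom := opMap i.inv
  inv := opMap i.hom
  hom_inv_id := by rw [← opMap_comp, i.hom_inv_id, opMap_id]
  inv_hom_id := by rw [← opMap_comp, i.inv_hom_id, opMap_id]

theorem op_op_lact (A : LocBimod X Y) (x : X) (a : A) :
    A.op.op.lact x (OrderDual.toDual (OrderDual.toDual a)) =
      OrderDual.toDual (OrderDual.toDual (A.lact x a)) :=
  congrArg (fun b => OrderDual.toDual (OrderDual.toDual b)) <|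
    eq_of_forall_ge_iff (α := A) fun b =>
      (A.op.le_rres (OrderDual.toDual a) (OrderDual.toDual b) x).trans (A.le_lres b a x)

theorem op_op_ract (A : LocBimod X Y) (a : A) (y : Y) :
    A.op.op.ract (OrderDual.toDual (OrderDual.toDual a)) y =
      OrderDual.toDual (OrderDual.toDual (A.ract a y)) :=
  congrArg (fun b => OrderDual.toDual (OrderDual.toDual b)) <|
    eq_of_forall_ge_iff (α := A) fun b =>
      (A.op.le_lres (OrderDual.toDual a) (OrderDual.toDual b) y).trans (A.le_rres b a y)

/-- `(A°)° ≅ A`. -/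
def opOpIso (A : LocBimod X Y) : A.op.op ≅ A where
  hom :=
    { toFun := fun a => OrderDual.ofDual (OrderDual.ofDual a)
      sup := SupPres.of_apply_le fun S b => sSup_le_iff (α := A)
      map_lact := fun x a => congrArg (fun b => OrderDual.ofDual (OrderDual.ofDual b))
        (A.op_op_lact x (OrderDual.ofDual (OrderDual.ofDual a)))
      map_ract := fun a y => congrArg (fun b => OrderDual.ofDual (OrderDual.ofDual b))
        (A.op_op_ract (OrderDual.ofDual (OrderDual.ofDual a)) y) }
  inv :=
    { toFun := fun a => OrderDual.toDual (OrderDual.toDual a)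
      sup := SupPres.of_apply_le fun S b => sSup_le_iff (α := A)
      map_lact := fun x a => (A.op_op_lact x a).symm
      map_ract := fun a y => (A.op_op_ract a y).symm }
  hom_inv_id := rfl
  inv_hom_id := rfl

/-! ### The tensor product over a locale

The tensor product `A ⊗_Y B` is the sup-lattice generated by symbols `a ⊗ b` subject to the
relations that `⊗` preserves suprema in each variable and `(a y) ⊗ b = a ⊗ (y b)`. The quotient of
the free sup-lattice `Set (A × B)` by these relations is realised by the saturated subsets. -/

/-- The subsets of `A × B` which are saturated for the relations defining `A ⊗_Y B`. -/
@[ext]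
structure TensorSet (A : LocBimod X Y) (B : LocBimod Y Z) where
  /-- the underlying subset of `A × B` -/
  set : Set (A × B)
  sSup_left : ∀ (S : Set A) (b : B), (sSup S, b) ∈ set ↔ ∀ a ∈ S, (a, b) ∈ set
  sSup_right : ∀ (a : A) (S : Set B), (a, sSup S) ∈ set ↔ ∀ b ∈ S, (a, b) ∈ set
  balanced : ∀ (a : A) (y : Y) (b : B), (A.ract a y, b) ∈ set ↔ (a, B.lact y b) ∈ set

namespace TensorSet

variable {A : LocBimod X Y} {B : LocBimod Y Z}

instance : PartialOrder (TensorSet A B) :=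
  PartialOrder.lift TensorSet.set fun _ _ h => TensorSet.ext h

instance : InfSet (TensorSet A B) where
  sInf T :=
    { set := {p | ∀ I ∈ T, p ∈ I.set}
      sSup_left := fun S b => by
        simp only [Set.mem_ofPred_eq, TensorSet.sSup_left]
        exact ⟨fun H a ha I hI => H I hI a ha, fun H I hI a ha => H a ha I hI⟩
      sSup_right := fun a S => by
        simp only [Set.mem_ofPred_eq, TensorSet.sSup_right]
        exact ⟨fun H a ha I hI => H I hI a ha, fun H I hI a ha => H a ha I hI⟩
      balanced := fun a y b => by
        simp only [Set.mem_ofPred_eq, TensorSet.balanced] }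

instance : CompleteLattice (TensorSet A B) :=
  completeLatticeOfInf _ fun _ => ⟨fun _ hI _ hp => hp _ hI, fun _ hJ _ hp _ hI => hJ hI hp⟩

/-- The element `a ⊗ b` of `A ⊗_Y B`. -/
def pure (a : A) (b : B) : TensorSet A B := sInf {I | (a, b) ∈ I.set}

theorem pure_le {a : A} {b : B} {I : TensorSet A B} : pure a b ≤ I ↔ (a, b) ∈ I.set :=
  ⟨fun h => h fun _ hJ => hJ, fun h => sInf_le h⟩

theorem pure_sup_left (b : B) : SupPres (fun a : A => pure a b) :=
  SupPres.of_apply_le fun S I => by simp only [pure_le, I.sSup_left]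

theorem pure_sup_right (a : A) : SupPres (fun b : B => pure a b) :=
  SupPres.of_apply_le fun S I => by simp only [pure_le, I.sSup_right]

theorem pure_balanced (a : A) (y : Y) (b : B) : pure (A.ract a y) b = pure a (B.lact y b) :=
  eq_of_forall_ge_iff fun I => by simp only [pure_le, I.balanced]

/-- Maps out of `A × B` preserving suprema in each variable and balanced over `Y`. -/
structure Bilin (A : LocBimod X Y) (B : LocBimod Y Z) {γ : Type u} [CompleteLattice γ]
    (φ : A → B → γ) : Prop where
  left : ∀ b, SupPres (fun a => φ a b)
  right : ∀ a, SupPres (fun b => φ a b)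
  balanced : ∀ a y b, φ (A.ract a y) b = φ a (B.lact y b)

variable {γ : Type u} [CompleteLattice γ]

/-- The sup-preserving map `A ⊗_Y B → γ`, `a ⊗ b ↦ φ a b`, induced by a bilinear map `φ`. -/
def lift (φ : A → B → γ) (I : TensorSet A B) : γ := ⨆ p : A × B, ⨆ _ : p ∈ I.set, φ p.1 p.2

theorem lift_le {φ : A → B → γ} {I : TensorSet A B} {c : γ} :
    lift φ I ≤ c ↔ ∀ a b, (a, b) ∈ I.set → φ a b ≤ c := by
  simp [lift, iSup_le_iff]

theorem lift_gc {φ : A → B → γ} (h : Bilin A B φ) :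
    GaloisConnection (lift φ) (fun c => (⟨{p | φ p.1 p.2 ≤ c},
      fun S b => (h.left b).apply_le S c, fun a S => (h.right a).apply_le S c,
      fun a y b => by simp only [Set.mem_ofPred_eq, h.balanced]⟩ : TensorSet A B)) := fun I c =>
  lift_le.trans ⟨fun H p hp => H p.1 p.2 hp, fun H _ _ hp => H hp⟩

theorem lift_sup {φ : A → B → γ} (h : Bilin A B φ) : SupPres (lift φ) := SupPres.of_gc (lift_gc h)

@[simp] theorem lift_pure {φ : A → B → γ} (h : Bilin A B φ) (a : A) (b : B) :
    lift φ (pure a b) = φ a b :=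
  eq_of_forall_ge_iff fun c => (lift_gc h _ c).trans pure_le

/-- Sup-preserving maps out of `A ⊗_Y B` are determined by their values on the `a ⊗ b`. -/
theorem ext_pure {f g : TensorSet A B → γ} (hf : SupPres f) (hg : SupPres g)
    (h : ∀ a b, f (pure a b) = g (pure a b)) (I : TensorSet A B) : f I = g I := by
  have hI : I = sSup {J | ∃ a b, (a, b) ∈ I.set ∧ J = pure a b} :=
    eq_of_forall_ge_iff fun K => by
      rw [sSup_le_iff]
      constructor
      · rintro hK J ⟨a, b, hab, rfl⟩
        exact pure_le.2 (hK hab)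
      · intro H p hp
        exact pure_le.1 (H _ ⟨p.1, p.2, hp, rfl⟩)
  rw [hI, hf, hg]
  congr 1
  apply Set.image_congr
  rintro J ⟨a, b, -, rfl⟩
  exact h a b

theorem bilin_pure (A : LocBimod X Y) (B : LocBimod Y Z) : Bilin A B pure :=
  ⟨pure_sup_left, pure_sup_right, pure_balanced⟩

/-- Composing a bilinear map with sup-preserving maps. -/
theorem Bilin.post {φ : A → B → γ} (h : Bilin A B φ) {δ : Type u} [CompleteLattice δ] {f : γ → δ}
    (hf : SupPres f) : Bilin A B (fun a b => f (φ a b)) :=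
  ⟨fun b => hf.comp (h.left b), fun a => hf.comp (h.right a), fun a y b => by rw [h.balanced]⟩

theorem lact_bilin (A : LocBimod X Y) (B : LocBimod Y Z) (x : X) :
    Bilin A B (fun a b => pure (A.lact x a) b) :=
  ⟨fun b => (pure_sup_left b).comp (A.lact_sup x), fun a => pure_sup_right _, fun a y b => by
    rw [A.lact_ract, pure_balanced]⟩

theorem ract_bilin (A : LocBimod X Y) (B : LocBimod Y Z) (z : Z) :
    Bilin A B (fun a b => pure a (B.ract b z)) :=
  ⟨fun b => pure_sup_left _, fun a => (pure_sup_right a).comp (B.sup_ract z), fun a y b => by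
    rw [pure_balanced, B.lact_ract]⟩

end TensorSet

open TensorSet

/-- The tensor product `A ⊗_Y B`, with actions `x (a ⊗ b) z = (x a) ⊗ (b z)`. -/
def tensor (A : LocBimod X Y) (B : LocBimod Y Z) : LocBimod X Z where
  carrier := TensorSet A B
  lact x := lift fun a b => pure (A.lact x a) b
  ract I z := lift (fun a b => pure a (B.ract b z)) I
  lact_sup x := lift_sup (lact_bilin A B x)
  sup_lact I := SupPres.pointwise _ fun p => (pure_sup_left p.2).comp (A.sup_lact p.1)
  lact_top := ext_pure (lift_sup (lact_bilin A B _)) SupPres.ident fun a b => by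
    rw [lift_pure (lact_bilin A B _), A.lact_top]
  lact_inf x x' := ext_pure (lift_sup (lact_bilin A B _))
    ((lift_sup (lact_bilin A B x)).comp (lift_sup (lact_bilin A B x'))) fun a b => by
    rw [lift_pure (lact_bilin A B _), lift_pure (lact_bilin A B _), lift_pure (lact_bilin A B _),
      A.lact_inf]
  ract_sup I := SupPres.pointwise _ fun p => (pure_sup_right p.1).comp (B.ract_sup p.2)
  sup_ract z := lift_sup (ract_bilin A B z)
  ract_top := ext_pure (lift_sup (ract_bilin A B _)) SupPres.ident fun a b => by
    rw [lift_pure (ract_bilin A B _), B.ract_top]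
  ract_inf I z z' := by
    revert I
    refine ext_pure (lift_sup (ract_bilin A B _))
      ((lift_sup (ract_bilin A B z')).comp (lift_sup (ract_bilin A B z))) fun a b => ?_
    rw [lift_pure (ract_bilin A B _), lift_pure (ract_bilin A B _), lift_pure (ract_bilin A B _),
      B.ract_inf]
  lact_ract x I z := by
    revert I
    refine ext_pure ((lift_sup (lact_bilin A B x)).comp (lift_sup (ract_bilin A B z)))
      ((lift_sup (ract_bilin A B z)).comp (lift_sup (lact_bilin A B x))) fun a b => ?_
    rw [lift_pure (ract_bilin A B _), lift_pure (lact_bilin A B _), lift_pure (lact_bilin A B _),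
      lift_pure (ract_bilin A B _)]

/-- The element `a ⊗ b` of `A ⊗_Y B`. -/
def tmul {A : LocBimod X Y} {B : LocBimod Y Z} (a : A) (b : B) : A.tensor B := TensorSet.pure a b

theorem bilin_tmul (A : LocBimod X Y) (B : LocBimod Y Z) :
    Bilin A B (tmul : A → B → A.tensor B) := bilin_pure A B

theorem lact_tmul {A : LocBimod X Y} {B : LocBimod Y Z} (x : X) (a : A) (b : B) :
    (A.tensor B).lact x (tmul a b) = tmul (A.lact x a) b := lift_pure (lact_bilin A B x) a b

theorem ract_tmul {A : LocBimod X Y} {B : LocBimod Y Z} (a : A) (b : B) (z : Z) :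
    (A.tensor B).ract (tmul a b) z = tmul a (B.ract b z) := lift_pure (ract_bilin A B z) a b

theorem tensor_ext {A : LocBimod X Y} {B : LocBimod Y Z} {γ : Type u} [CompleteLattice γ]
    {f g : A.tensor B → γ} (hf : SupPres f) (hg : SupPres g)
    (h : ∀ a b, f (tmul a b) = g (tmul a b)) (s : A.tensor B) : f s = g s := ext_pure hf hg h s

theorem tensor_hom_ext {A : LocBimod X Y} {B : LocBimod Y Z} {C : LocBimod X Z} {f g : A.tensor B ⟶ C}
    (h : ∀ a b, f.toFun (tmul a b) = g.toFun (tmul a b)) : f = g :=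
  hom_ext (tensor_ext f.sup g.sup h)

/-- The sup-preserving map `A ⊗_Y B → γ`, `a ⊗ b ↦ φ a b`. -/
def tlift {A : LocBimod X Y} {B : LocBimod Y Z} {γ : Type u} [CompleteLattice γ]
    (φ : A → B → γ) (s : A.tensor B) : γ := lift φ s

theorem tlift_sup {A : LocBimod X Y} {B : LocBimod Y Z} {γ : Type u} [CompleteLattice γ]
    {φ : A → B → γ} (h : Bilin A B φ) : SupPres (tlift φ) := lift_sup h

theorem tlift_tmul {A : LocBimod X Y} {B : LocBimod Y Z} {γ : Type u} [CompleteLattice γ]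
    {φ : A → B → γ} (h : Bilin A B φ) (a : A) (b : B) : tlift φ (tmul a b) = φ a b :=
  lift_pure h a b

/-- The bimodule homomorphism `a ⊗ b ↦ φ a b` out of a tensor product. -/
def tensorLift {A : LocBimod X Y} {B : LocBimod Y Z} {C : LocBimod X Z} (φ : A → B → C) (h : Bilin A B φ)
    (hl : ∀ x a b, φ (A.lact x a) b = C.lact x (φ a b))
    (hr : ∀ a b z, φ a (B.ract b z) = C.ract (φ a b) z) : A.tensor B ⟶ C where
  toFun := tlift φ
  sup := tlift_sup h
  map_lact x := tensor_ext ((tlift_sup h).comp ((A.tensor B).lact_sup x))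
    ((C.lact_sup x).comp (tlift_sup h)) fun a b => by
      rw [lact_tmul, tlift_tmul h, tlift_tmul h, hl]
  map_ract s z := by
    revert s
    refine tensor_ext ((tlift_sup h).comp ((A.tensor B).sup_ract z))
      ((C.sup_ract z).comp (tlift_sup h)) fun a b => ?_
    rw [ract_tmul, tlift_tmul h, tlift_tmul h, hr]

@[simp] theorem tensorLift_tmul {A : LocBimod X Y} {B : LocBimod Y Z} {C : LocBimod X Z} (φ : A → B → C)
    (h : Bilin A B φ) (hl : ∀ x a b, φ (A.lact x a) b = C.lact x (φ a b))
    (hr : ∀ a b z, φ a (B.ract b z) = C.ract (φ a b) z) (a : A) (b : B) :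
    (tensorLift φ h hl hr).toFun (tmul a b) = φ a b := tlift_tmul h a b

/-- `f ⊗ g : a ⊗ b ↦ f a ⊗ g b`. -/
def tensorMap {A A' : LocBimod X Y} {B B' : LocBimod Y Z} (f : A ⟶ A') (g : B ⟶ B') :
    A.tensor B ⟶ A'.tensor B' :=
  tensorLift (fun a b => tmul (f.toFun a) (g.toFun b))
    ⟨fun _ => ((bilin_tmul A' B').left _).comp f.sup,
      fun _ => ((bilin_tmul A' B').right _).comp g.sup,
      fun a y b => by rw [f.map_ract, g.map_lact, (bilin_tmul A' B').balanced]⟩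
    (fun x a b => by rw [f.map_lact, lact_tmul]) (fun a b z => by rw [g.map_ract, ract_tmul])

@[simp] theorem tensorMap_tmul {A A' : LocBimod X Y} {B B' : LocBimod Y Z} (f : A ⟶ A') (g : B ⟶ B')
    (a : A) (b : B) : (tensorMap f g).toFun (tmul a b) = tmul (f.toFun a) (g.toFun b) :=
  tensorLift_tmul ..

theorem tensorMap_id (A : LocBimod X Y) (B : LocBimod Y Z) : tensorMap (𝟙 A) (𝟙 B) = 𝟙 (A.tensor B) :=
  tensor_hom_ext fun a b => by simp

theorem tensorMap_comp {A A' A'' : LocBimod X Y} {B B' B'' : LocBimod Y Z} (f : A ⟶ A') (f' : A' ⟶ A'')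
    (g : B ⟶ B') (g' : B' ⟶ B'') :
    tensorMap (f ≫ f') (g ≫ g') = tensorMap f g ≫ tensorMap f' g' :=
  tensor_hom_ext fun a b => by simp

/-- Isomorphisms can be tensored. -/
def tensorIso {A A' : LocBimod X Y} {B B' : LocBimod Y Z} (i : A ≅ A') (j : B ≅ B') :
    A.tensor B ≅ A'.tensor B' where
  hom := tensorMap i.hom j.hom
  inv := tensorMap i.inv j.inv
  hom_inv_id := by rw [← tensorMap_comp, i.hom_inv_id, j.hom_inv_id, tensorMap_id]
  inv_hom_id := by rw [← tensorMap_comp, i.inv_hom_id, j.inv_hom_id, tensorMap_id]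

theorem bilin_tmul_tmul_left (A : LocBimod X Y) (B : LocBimod Y Z) {C : LocBimod Z W} (c : C) :
    Bilin A B (fun a b => (tmul a (tmul b c) : A.tensor (B.tensor C))) :=
  ⟨fun b => (bilin_tmul _ _).left _,
    fun a => ((bilin_tmul A (B.tensor C)).right a).comp ((bilin_tmul B C).left c),
    fun a y b => by rw [(bilin_tmul _ _).balanced, lact_tmul]⟩

theorem bilin_tmul_tmul_right {A : LocBimod X Y} (a : A) (B : LocBimod Y Z) (C : LocBimod Z W) :
    Bilin B C (fun b c => (tmul (tmul a b) c : (A.tensor B).tensor C)) :=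
  ⟨fun c => ((bilin_tmul (A.tensor B) C).left c).comp ((bilin_tmul A B).right a),
    fun b => (bilin_tmul _ _).right _,
    fun b z c => by rw [← (bilin_tmul _ _).balanced, ract_tmul]⟩

/-- `(a ⊗ b) ⊗ c ↦ a ⊗ (b ⊗ c)` -/
def tensorAssocHom (A : LocBimod X Y) (B : LocBimod Y Z) (C : LocBimod Z W) :
    (A.tensor B).tensor C ⟶ A.tensor (B.tensor C) :=
  have hc (c : C) := bilin_tmul_tmul_left A B c
  tensorLift (fun (s : A.tensor B) c => tlift (fun a b => tmul a (tmul b c)) s)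
    ⟨fun c => tlift_sup (hc c),
      fun s => SupPres.pointwise _ fun p =>
        ((bilin_tmul A (B.tensor C)).right p.1).comp ((bilin_tmul B C).right p.2),
      fun s z c => by
        revert s
        refine tensor_ext ((tlift_sup (hc c)).comp ((A.tensor B).sup_ract z)) (tlift_sup (hc _))
          fun a b => ?_
        rw [ract_tmul, tlift_tmul (hc c), tlift_tmul (hc _), (bilin_tmul B C).balanced]⟩
    (fun x s c => by
      revert s
      refine tensor_ext ((tlift_sup (hc c)).comp ((A.tensor B).lact_sup x))
        (((A.tensor (B.tensor C)).lact_sup x).comp (tlift_sup (hc c))) fun a b => ?_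
      rw [lact_tmul, tlift_tmul (hc c), tlift_tmul (hc c), lact_tmul])
    (fun s c w => by
      revert s
      refine tensor_ext (tlift_sup (hc _))
        (((A.tensor (B.tensor C)).sup_ract w).comp (tlift_sup (hc c))) fun a b => ?_
      rw [tlift_tmul (hc _), tlift_tmul (hc c), ract_tmul, ract_tmul])

@[simp] theorem tensorAssocHom_tmul (A : LocBimod X Y) (B : LocBimod Y Z) (C : LocBimod Z W)
    (a : A) (b : B) (c : C) :
    (tensorAssocHom A B C).toFun (tmul (tmul a b) c) = tmul a (tmul b c) := by
  rw [tensorAssocHom, tensorLift_tmul, tlift_tmul (bilin_tmul_tmul_left A B c)]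

/-- `a ⊗ (b ⊗ c) ↦ (a ⊗ b) ⊗ c` -/
def tensorAssocInv (A : LocBimod X Y) (B : LocBimod Y Z) (C : LocBimod Z W) :
    A.tensor (B.tensor C) ⟶ (A.tensor B).tensor C :=
  have ha (a : A) := bilin_tmul_tmul_right a B C
  tensorLift (fun a (s : B.tensor C) => tlift (fun b c => tmul (tmul a b) c) s)
    ⟨fun s => SupPres.pointwise _ fun p =>
        ((bilin_tmul (A.tensor B) C).left p.2).comp ((bilin_tmul A B).left p.1),
      fun a => tlift_sup (ha a),
      fun a y s => by
        revert s
        refine tensor_ext (tlift_sup (ha _)) ((tlift_sup (ha a)).comp ((B.tensor C).lact_sup y))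
          fun b c => ?_
        rw [lact_tmul, tlift_tmul (ha _), tlift_tmul (ha _), (bilin_tmul A B).balanced]⟩
    (fun x a s => by
      revert s
      refine tensor_ext (tlift_sup (ha _))
        ((((A.tensor B).tensor C).lact_sup x).comp (tlift_sup (ha a))) fun b c => ?_
      rw [tlift_tmul (ha _), tlift_tmul (ha a), lact_tmul, lact_tmul])
    (fun a s w => by
      revert s
      refine tensor_ext ((tlift_sup (ha a)).comp ((B.tensor C).sup_ract w))
        ((((A.tensor B).tensor C).sup_ract w).comp (tlift_sup (ha a))) fun b c => ?_
      rw [ract_tmul, tlift_tmul (ha a), tlift_tmul (ha a), ract_tmul])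

@[simp] theorem tensorAssocInv_tmul (A : LocBimod X Y) (B : LocBimod Y Z) (C : LocBimod Z W)
    (a : A) (b : B) (c : C) :
    (tensorAssocInv A B C).toFun (tmul a (tmul b c)) = tmul (tmul a b) c := by
  rw [tensorAssocInv, tensorLift_tmul, tlift_tmul (bilin_tmul_tmul_right a B C)]

/-- The associator `(A ⊗ B) ⊗ C ≅ A ⊗ (B ⊗ C)`. -/
def tensorAssoc (A : LocBimod X Y) (B : LocBimod Y Z) (C : LocBimod Z W) :
    (A.tensor B).tensor C ≅ A.tensor (B.tensor C) where
  hom := tensorAssocHom A B C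
  inv := tensorAssocInv A B C
  hom_inv_id := tensor_hom_ext fun s c => by
    revert s
    refine tensor_ext
      ((Hom.sup (tensorAssocHom A B C ≫ tensorAssocInv A B C)).comp ((bilin_tmul _ _).left c))
      ((Hom.sup (𝟙 ((A.tensor B).tensor C))).comp ((bilin_tmul _ _).left c)) fun a b => by simp
  inv_hom_id := tensor_hom_ext fun a s => by
    revert s
    refine tensor_ext
      ((Hom.sup (tensorAssocInv A B C ≫ tensorAssocHom A B C)).comp ((bilin_tmul _ _).right a))
      ((Hom.sup (𝟙 (A.tensor (B.tensor C)))).comp ((bilin_tmul _ _).right a)) fun b c => by simp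

theorem lact_unit_bilin (A : LocBimod X Y) : Bilin (unit X) A (fun x a => A.lact x a) :=
  ⟨fun a => A.sup_lact a, fun x => A.lact_sup x, fun x x' a => A.lact_inf x x' a⟩

theorem ract_unit_bilin (A : LocBimod X Y) : Bilin A (unit Y) (fun a y => A.ract a y) :=
  ⟨fun y => A.sup_ract y, fun a => A.ract_sup a, fun a y y' => (A.ract_inf a y y').symm⟩

/-- The element `⊤` of the bimodule `X`. -/
def unitTop (X : Type u) [Order.Frame X] : unit X := (⊤ : X)

theorem tmul_unitTop_left (A : LocBimod X Y) (x : unit X) (a : A) :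
    tmul (unitTop X) (A.lact x a) = tmul x a :=
  ((bilin_tmul (unit X) A).balanced (unitTop X) x a).symm.trans
    (congrArg (fun x' : unit X => (tmul x' a : (unit X).tensor A)) (top_inf_eq (α := X) x))

theorem tmul_unitTop_right (A : LocBimod X Y) (a : A) (y : unit Y) :
    tmul (A.ract a y) (unitTop Y) = tmul a y :=
  ((bilin_tmul A (unit Y)).balanced a y (unitTop Y)).trans
    (congrArg (fun y' : unit Y => (tmul a y' : A.tensor (unit Y))) (inf_top_eq (α := Y) y))

/-- `X ⊗ A ⟶ A`, `x ⊗ a ↦ x a` -/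
def tensorLeftUnitorHom (A : LocBimod X Y) : (unit X).tensor A ⟶ A :=
  tensorLift (fun x a => A.lact x a) (lact_unit_bilin A)
    (fun x x' a => A.lact_inf x x' a) (fun x a y => A.lact_ract x a y)

theorem tensorLeftUnitorHom_tmul (A : LocBimod X Y) (x : unit X) (a : A) :
    (tensorLeftUnitorHom A).toFun (tmul x a) = A.lact x a := tensorLift_tmul ..

/-- `A ⊗ Y ⟶ A`, `a ⊗ y ↦ a y` -/
def tensorRightUnitorHom (A : LocBimod X Y) : A.tensor (unit Y) ⟶ A :=
  tensorLift (fun a y => A.ract a y) (ract_unit_bilin A)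
    (fun x a y => (A.lact_ract x a y).symm) (fun a y y' => A.ract_inf a y y')

theorem tensorRightUnitorHom_tmul (A : LocBimod X Y) (a : A) (y : unit Y) :
    (tensorRightUnitorHom A).toFun (tmul a y) = A.ract a y := tensorLift_tmul ..

/-- The left unitor `X ⊗ A ≅ A`. -/
def tensorLeftUnitor (A : LocBimod X Y) : (unit X).tensor A ≅ A where
  hom := tensorLeftUnitorHom A
  inv :=
    { toFun := fun a => tmul (unitTop X) a
      sup := (bilin_tmul _ _).right _
      map_lact := fun x a => (tmul_unitTop_left A x a).trans <|
        (congrArg (fun x' : unit X => (tmul x' a : (unit X).tensor A))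
          (inf_top_eq (α := X) x)).symm.trans (lact_tmul x (unitTop X) a).symm
      map_ract := fun a y => (ract_tmul _ _ _).symm }
  hom_inv_id := tensor_hom_ext fun x a =>
    (congrArg (fun b => tmul (unitTop X) b) (tensorLeftUnitorHom_tmul A x a)).trans
      (tmul_unitTop_left A x a)
  inv_hom_id := hom_ext fun a => (tensorLeftUnitorHom_tmul A (unitTop X) a).trans (A.lact_top a)

/-- The right unitor `A ⊗ Y ≅ A`. -/
def tensorRightUnitor (A : LocBimod X Y) : A.tensor (unit Y) ≅ A where
  hom := tensorRightUnitorHom A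
  inv :=
    { toFun := fun a => tmul a (unitTop Y)
      sup := (bilin_tmul _ _).left _
      map_lact := fun x a => (lact_tmul _ _ _).symm
      map_ract := fun a y => (tmul_unitTop_right A a y).trans <|
        (congrArg (fun y' : unit Y => (tmul a y' : A.tensor (unit Y)))
          (top_inf_eq (α := Y) y)).symm.trans (ract_tmul a (unitTop Y) y).symm }
  hom_inv_id := tensor_hom_ext fun a y =>
    (congrArg (fun b => tmul b (unitTop Y)) (tensorRightUnitorHom_tmul A a y)).trans
      (tmul_unitTop_right A a y)
  inv_hom_id := hom_ext fun a => (tensorRightUnitorHom_tmul A a (unitTop Y)).trans (A.ract_top a)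

/-! ### The second composition -/

/-- `A ⊕ B = (B° ⊗ A°)°` -/
def par (A : LocBimod X Y) (B : LocBimod Y Z) : LocBimod X Z := (B.op.tensor A.op).op

/-- `f ⊕ g = (g° ⊗ f°)°` -/
def parMap {A A' : LocBimod X Y} {B B' : LocBimod Y Z} (f : A ⟶ A') (g : B ⟶ B') :
    A.par B ⟶ A'.par B' :=
  opMap (tensorMap (opMap g) (opMap f))

/-- `(A ⊕ B) ⊕ C = (C° ⊗ (B° ⊗ A°)°°)° ≅ (C° ⊗ (B° ⊗ A°))° ≅ ((C° ⊗ B°) ⊗ A°)° ≅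
((C° ⊗ B°)°° ⊗ A°)° = A ⊕ (B ⊕ C)` -/
def parAssoc (A : LocBimod X Y) (B : LocBimod Y Z) (C : LocBimod Z W) :
    (A.par B).par C ≅ A.par (B.par C) :=
  opIso (tensorIso (Iso.refl C.op) (opOpIso (B.op.tensor A.op)) ≪≫
    (tensorAssoc C.op B.op A.op).symm ≪≫
    tensorIso (opOpIso (C.op.tensor B.op)).symm (Iso.refl A.op))

/-- `X° ⊕ A = (A° ⊗ X°°)° ≅ (A° ⊗ X)° ≅ A°° ≅ A` -/
def parLeftUnitor (A : LocBimod X Y) : (unit X).op.par A ≅ A :=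
  opIso (tensorIso (Iso.refl A.op) (opOpIso (unit X)) ≪≫ tensorRightUnitor A.op) ≪≫ opOpIso A

/-- `A ⊕ Y° = (Y°° ⊗ A°)° ≅ (Y ⊗ A°)° ≅ A°° ≅ A` -/
def parRightUnitor (A : LocBimod X Y) : A.par (unit Y).op ≅ A :=
  opIso (tensorIso (opOpIso (unit Y)) (Iso.refl A.op) ≪≫ tensorLeftUnitor A.op) ≪≫ opOpIso A

/-! ### Bimodules of module homomorphisms -/

/-- Left `X`-module homomorphisms. -/
@[ext]
structure LeftHom (A : LocBimod X Y) (C : LocBimod X Z) where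
  /-- the underlying map -/
  toFun : A → C
  sup : SupPres toFun
  map_lact : ∀ x a, toFun (A.lact x a) = C.lact x (toFun a)

/-- Right `Y`-module homomorphisms. -/
@[ext]
structure RightHom (A : LocBimod X Y) (B : LocBimod W Y) where
  /-- the underlying map -/
  toFun : A → B
  sup : SupPres toFun
  map_ract : ∀ a y, toFun (A.ract a y) = B.ract (toFun a) y

section

variable {A : LocBimod X Y} {C : LocBimod X Z}

instance : PartialOrder (LeftHom A C) :=
  PartialOrder.lift LeftHom.toFun fun _ _ h => LeftHom.ext h

instance : SupSet (LeftHom A C) where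
  sSup F :=
    { toFun := fun a => ⨆ f : LeftHom A C, ⨆ _ : f ∈ F, f.toFun a
      sup := SupPres.pointwise _ fun f => f.sup
      map_lact := fun x a => by
        rw [(C.lact_sup x).gc.l_iSup₂]
        simp only [LeftHom.map_lact] }

instance : CompleteLattice (LeftHom A C) :=
  completeLatticeOfSup _ fun _ =>
    ⟨fun f hf a => le_iSup₂ (f := fun (f : LeftHom A C) _ => f.toFun a) f hf,
      fun _ hg a => iSup₂_le fun _ hf => hg hf a⟩

theorem LeftHom.sSup_apply_le (F : Set (LeftHom A C)) (a : A) (c : C) :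
    (sSup F).toFun a ≤ c ↔ ∀ f ∈ F, f.toFun a ≤ c := iSup₂_le_iff

end

section

variable {A : LocBimod X Y} {B : LocBimod W Y}

instance : PartialOrder (RightHom A B) :=
  PartialOrder.lift RightHom.toFun fun _ _ h => RightHom.ext h

instance : SupSet (RightHom A B) where
  sSup F :=
    { toFun := fun a => ⨆ f : RightHom A B, ⨆ _ : f ∈ F, f.toFun a
      sup := SupPres.pointwise _ fun f => f.sup
      map_ract := fun a y => by
        rw [(B.sup_ract y).gc.l_iSup₂]
        simp only [RightHom.map_ract] }

instance : CompleteLattice (RightHom A B) :=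
  completeLatticeOfSup _ fun _ =>
    ⟨fun f hf a => le_iSup₂ (f := fun (f : RightHom A B) _ => f.toFun a) f hf,
      fun _ hg a => iSup₂_le fun _ hf => hg hf a⟩

theorem RightHom.sSup_apply_le (F : Set (RightHom A B)) (a : A) (b : B) :
    (sSup F).toFun a ≤ b ↔ ∀ f ∈ F, f.toFun a ≤ b := iSup₂_le_iff

end

/-- `XMod(A, C)`, the `(Y, Z)`-bimodule of left `X`-module homomorphisms, with
`(y f z)(a) = f (a y) z`. -/
def homL (A : LocBimod X Y) (C : LocBimod X Z) : LocBimod Y Z where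
  carrier := LeftHom A C
  lact y f := ⟨fun a => f.toFun (A.ract a y), f.sup.comp (A.sup_ract y), fun x a => by
    rw [← A.lact_ract, f.map_lact]⟩
  ract f z := ⟨fun a => C.ract (f.toFun a) z, (C.sup_ract z).comp f.sup, fun x a => by
    rw [f.map_lact, C.lact_ract]⟩
  lact_sup y := SupPres.of_apply_le fun S g => by
    have key a := LeftHom.sSup_apply_le S (A.ract a y) (g.toFun a)
    exact ⟨fun H f hf a => (key a).1 (H a) f hf, fun H a => (key a).2 fun f hf => H f hf a⟩
  sup_lact f := SupPres.of_apply_le fun S g =>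
    ⟨fun H y hy a => ((f.sup.comp (A.ract_sup a)).apply_le S (g.toFun a)).1 (H a) y hy,
      fun H a => ((f.sup.comp (A.ract_sup a)).apply_le S (g.toFun a)).2 fun y hy => H y hy a⟩
  lact_top f := LeftHom.ext <| funext fun a => congrArg f.toFun (A.ract_top a)
  lact_inf y y' f := LeftHom.ext <| funext fun a => congrArg f.toFun (A.ract_inf a y y')
  ract_sup f := SupPres.of_apply_le fun S g =>
    ⟨fun H z hz a => ((C.ract_sup (f.toFun a)).apply_le S (g.toFun a)).1 (H a) z hz,
      fun H a => ((C.ract_sup (f.toFun a)).apply_le S (g.toFun a)).2 fun z hz => H z hz a⟩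
  sup_ract z := SupPres.of_apply_le fun S g => by
    have key : ∀ a, C.ract ((sSup S).toFun a) z ≤ g.toFun a ↔
        ∀ f ∈ S, C.ract (f.toFun a) z ≤ g.toFun a := fun a => by
      simp only [← C.le_rres, LeftHom.sSup_apply_le]
    exact ⟨fun H f hf a => (key a).1 (H a) f hf, fun H a => (key a).2 fun f hf => H f hf a⟩
  ract_top f := LeftHom.ext <| funext fun a => C.ract_top _
  ract_inf f z z' := LeftHom.ext <| funext fun a => C.ract_inf _ z z'
  lact_ract y f z := rfl

/-- `ModY(A, B)`, the `(W, X)`-bimodule of right `Y`-module homomorphisms, with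
`(w f x)(a) = w f (x a)`. -/
def homR (A : LocBimod X Y) (B : LocBimod W Y) : LocBimod W X where
  carrier := RightHom A B
  lact w f := ⟨fun a => B.lact w (f.toFun a), (B.lact_sup w).comp f.sup, fun a y => by
    rw [f.map_ract, B.lact_ract]⟩
  ract f x := ⟨fun a => f.toFun (A.lact x a), f.sup.comp (A.lact_sup x), fun a y => by
    rw [A.lact_ract, f.map_ract]⟩
  lact_sup w := SupPres.of_apply_le fun S g => by
    have key : ∀ a, B.lact w ((sSup S).toFun a) ≤ g.toFun a ↔
        ∀ f ∈ S, B.lact w (f.toFun a) ≤ g.toFun a := fun a => by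
      simp only [← B.le_lres, RightHom.sSup_apply_le]
    exact ⟨fun H f hf a => (key a).1 (H a) f hf, fun H a => (key a).2 fun f hf => H f hf a⟩
  sup_lact f := SupPres.of_apply_le fun S g =>
    ⟨fun H w hw a => ((B.sup_lact (f.toFun a)).apply_le S (g.toFun a)).1 (H a) w hw,
      fun H a => ((B.sup_lact (f.toFun a)).apply_le S (g.toFun a)).2 fun w hw => H w hw a⟩
  lact_top f := RightHom.ext <| funext fun a => B.lact_top _
  lact_inf w w' f := RightHom.ext <| funext fun a => B.lact_inf w w' _
  ract_sup f := SupPres.of_apply_le fun S g =>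
    ⟨fun H x hx a => ((f.sup.comp (A.sup_lact a)).apply_le S (g.toFun a)).1 (H a) x hx,
      fun H a => ((f.sup.comp (A.sup_lact a)).apply_le S (g.toFun a)).2 fun x hx => H x hx a⟩
  sup_ract x := SupPres.of_apply_le fun S g =>
    have key a := RightHom.sSup_apply_le S (A.lact x a) (g.toFun a)
    ⟨fun H f hf a => (key a).1 (H a) f hf, fun H a => (key a).2 fun f hf => H f hf a⟩
  ract_top f := RightHom.ext <| funext fun a => congrArg f.toFun (A.lact_top a)
  ract_inf f x x' := RightHom.ext <| funext fun a => congrArg f.toFun (A.lact_inf x x' a)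
  lact_ract w f x := rfl

/-- `f ↦ k ∘ f ∘ h` -/
def homLMap {A A' : LocBimod X Y} {C C' : LocBimod X Z} (h : A' ⟶ A) (k : C ⟶ C') :
    homL A C ⟶ homL A' C' where
  toFun := fun f : LeftHom A C => (⟨fun a => k.toFun (f.toFun (h.toFun a)),
    k.sup.comp (f.sup.comp h.sup), fun x a => by
      rw [h.map_lact, f.map_lact, k.map_lact]⟩ : LeftHom A' C')
  sup := SupPres.of_apply_le fun S g => by
    have key : ∀ a, k.toFun ((sSup S : LeftHom A C).toFun (h.toFun a)) ≤ LeftHom.toFun g a ↔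
        ∀ f ∈ S, k.toFun (LeftHom.toFun f (h.toFun a)) ≤ LeftHom.toFun g a := fun a => by
      simp only [← le_adj]
      exact LeftHom.sSup_apply_le S _ _
    exact ⟨fun H f hf a => (key a).1 (H a) f hf, fun H a => (key a).2 fun f hf => H f hf a⟩
  map_lact y f := LeftHom.ext <| funext fun a =>
    congrArg (fun b => k.toFun (LeftHom.toFun f b)) (h.map_ract a y).symm
  map_ract f z := LeftHom.ext <| funext fun a => k.map_ract _ z

/-- `f ↦ k ∘ f ∘ h` -/
def homRMap {A A' : LocBimod X Y} {B B' : LocBimod W Y} (h : A' ⟶ A) (k : B ⟶ B') :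
    homR A B ⟶ homR A' B' where
  toFun := fun f : RightHom A B => (⟨fun a => k.toFun (f.toFun (h.toFun a)),
    k.sup.comp (f.sup.comp h.sup), fun a y => by
      rw [h.map_ract, f.map_ract, k.map_ract]⟩ : RightHom A' B')
  sup := SupPres.of_apply_le fun S g => by
    have key : ∀ a, k.toFun ((sSup S : RightHom A B).toFun (h.toFun a)) ≤ RightHom.toFun g a ↔
        ∀ f ∈ S, k.toFun (RightHom.toFun f (h.toFun a)) ≤ RightHom.toFun g a := fun a => by
      simp only [← le_adj]
      exact RightHom.sSup_apply_le S _ _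
    exact ⟨fun H f hf a => (key a).1 (H a) f hf, fun H a => (key a).2 fun f hf => H f hf a⟩
  map_lact w f := RightHom.ext <| funext fun a => k.map_lact w _
  map_ract f x := RightHom.ext <| funext fun a =>
    congrArg (fun b => k.toFun (RightHom.toFun f b)) (h.map_lact x a).symm

/-- `XMod(A, C) ≅ XMod(A, C')` for `C ≅ C'`. -/
def homLIso (A : LocBimod X Y) {C C' : LocBimod X Z} (i : C ≅ C') : homL A C ≅ homL A C' where
  hom := homLMap (𝟙 A) i.hom
  inv := homLMap (𝟙 A) i.inv
  hom_inv_id := hom_ext fun f => LeftHom.ext <| funext fun a =>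
    congrFun (congrArg Hom.toFun i.hom_inv_id) (LeftHom.toFun f a)
  inv_hom_id := hom_ext fun f => LeftHom.ext <| funext fun a =>
    congrFun (congrArg Hom.toFun i.inv_hom_id) (LeftHom.toFun f a)

/-- `ModY(A, B) ≅ ModY(A, B')` for `B ≅ B'`. -/
def homRIso (A : LocBimod X Y) {B B' : LocBimod W Y} (i : B ≅ B') : homR A B ≅ homR A B' where
  hom := homRMap (𝟙 A) i.hom
  inv := homRMap (𝟙 A) i.inv
  hom_inv_id := hom_ext fun f => RightHom.ext <| funext fun a =>
    congrFun (congrArg Hom.toFun i.hom_inv_id) (RightHom.toFun f a)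
  inv_hom_id := hom_ext fun f => RightHom.ext <| funext fun a =>
    congrFun (congrArg Hom.toFun i.inv_hom_id) (RightHom.toFun f a)

/-- A bijective bimodule homomorphism is an isomorphism. -/
def isoOfInverse {A B : LocBimod X Y} (f : A ⟶ B) (g : B → A) (h : ∀ a, g (f.toFun a) = a)
    (h' : ∀ b, f.toFun (g b) = b) : A ≅ B where
  hom := f
  inv :=
    { toFun := g
      sup := fun S => by
        rw [← h (sSup (g '' S)), f.sup, Set.image_image]
        simp only [h', Set.image_id']
      map_lact := fun x b => by rw [← h (A.lact x (g b)), f.map_lact, h']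
      map_ract := fun b y => by rw [← h (A.ract (g b) y), f.map_ract, h'] }
  hom_inv_id := hom_ext h
  inv_hom_id := hom_ext h'

/-! ### The tensor product in terms of module homomorphisms -/

section

variable {A : LocBimod X Y} {B : LocBimod Y Z}

/-- The largest `b` with `a ⊗ b ≤ s`. -/
def fibR (s : A.tensor B) (a : A) : B := radj (fun b => tmul a b) s

/-- The largest `a` with `a ⊗ b ≤ s`. -/
def fibL (s : A.tensor B) (b : B) : A := radj (fun a => tmul a b) s

theorem le_fibR (s : A.tensor B) (a : A) (b : B) : b ≤ fibR s a ↔ tmul a b ≤ s :=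
  (((bilin_tmul A B).right a).gc b s).symm

theorem le_fibL (s : A.tensor B) (a : A) (b : B) : a ≤ fibL s b ↔ tmul a b ≤ s :=
  (((bilin_tmul A B).left b).gc a s).symm

theorem tmul_le_sInf (S : Set (A.tensor B)) (a : A) (b : B) :
    tmul a b ≤ sInf S ↔ ∀ s ∈ S, tmul a b ≤ s := le_sInf_iff

theorem tensor_eq_of_tmul_le {s s' : A.tensor B} (h : ∀ a b, tmul a b ≤ s ↔ tmul a b ≤ s') :
    s = s' :=
  TensorSet.ext <| Set.ext fun p =>
    (TensorSet.pure_le (A := A) (B := B)).symm.trans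
      ((h p.1 p.2).trans (TensorSet.pure_le (A := A) (B := B)))

/-- The right module homomorphism `A → B°` given by an element of `A ⊗_Y B`. -/
def toRightHom (s : A.tensor B) : RightHom A B.op where
  toFun a := OrderDual.toDual (fibR (A := A) (B := B) s a)
  sup := SupPres.of_apply_le fun S (b : B) =>
    (le_fibR s (sSup S) b).trans <| (((bilin_tmul A B).left b).apply_le S s).trans <|
      forall₂_congr fun a _ => (le_fibR s a b).symm
  map_ract a y := congrArg OrderDual.toDual <| eq_of_forall_le_iff (α := B) fun b => by
    refine (le_fibR s _ b).trans (Iff.trans ?_ (B.le_lres _ _ _).symm)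
    rw [(bilin_tmul A B).balanced]
    exact (le_fibR s a _).symm

/-- The left module homomorphism `B → A°` given by an element of `A ⊗_Y B`. -/
def toLeftHom (s : A.tensor B) : LeftHom B A.op where
  toFun b := OrderDual.toDual (fibL (A := A) (B := B) s b)
  sup := SupPres.of_apply_le fun S (a : A) =>
    (le_fibL s a (sSup S)).trans <| (((bilin_tmul A B).right a).apply_le S s).trans <|
      forall₂_congr fun b _ => (le_fibL s a b).symm
  map_lact y b := congrArg OrderDual.toDual <| eq_of_forall_le_iff (α := A) fun a => by
    refine (le_fibL s a _).trans (Iff.trans ?_ (A.le_rres _ _ _).symm)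
    rw [← (bilin_tmul A B).balanced]
    exact (le_fibL s _ b).symm

/-- The element of `A ⊗_Y B` given by a right module homomorphism `A → B°`. -/
def ofRightHom (f : RightHom A B.op) : TensorSet A B where
  set := {p | p.2 ≤ OrderDual.ofDual (α := B) (f.toFun p.1)}
  sSup_left S b := f.sup.apply_le S (OrderDual.toDual b)
  sSup_right a S := sSup_le_iff
  balanced a y b :=
    (iff_of_eq (congrArg (fun c : B.op => b ≤ OrderDual.ofDual (α := B) c)
      (f.map_ract a y))).trans (B.le_lres _ _ _)

/-- The element of `A ⊗_Y B` given by a left module homomorphism `B → A°`. -/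
def ofLeftHom (f : LeftHom B A.op) : TensorSet A B where
  set := {p | p.1 ≤ OrderDual.ofDual (α := A) (f.toFun p.2)}
  sSup_left S b := sSup_le_iff
  sSup_right a S := f.sup.apply_le S (OrderDual.toDual a)
  balanced a y b :=
    ((iff_of_eq (congrArg (fun c : A.op => a ≤ OrderDual.ofDual (α := A) c)
      (f.map_lact y b))).trans (A.le_rres _ _ _)).symm

end

/-- `(A ⊗_Y B)° ≅ ModY(A, B°)` -/
def tensorOpIsoR (A : LocBimod X Y) (B : LocBimod Y Z) : (A.tensor B).op ≅ homR A B.op :=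
  isoOfInverse
    { toFun := fun s => toRightHom (A := A) (B := B) (OrderDual.ofDual s)
      sup := SupPres.of_apply_le fun S (f : RightHom A B.op) => by
        have key : ∀ a, OrderDual.ofDual (α := B) (f.toFun a) ≤
            fibR (sInf (OrderDual.toDual ⁻¹' S) : A.tensor B) a ↔
            ∀ s ∈ S, OrderDual.ofDual (α := B) (f.toFun a) ≤
              fibR (OrderDual.ofDual s : A.tensor B) a := fun a => by
          simp only [le_fibR, tmul_le_sInf]
          exact Iff.rfl
        exact ⟨fun H s hs a => (key a).1 (H a) s hs, fun H a => (key a).2 fun s hs => H s hs a⟩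
      map_lact := fun z s => RightHom.ext <| funext fun a => congrArg OrderDual.toDual <|
        eq_of_forall_le_iff (α := B) fun b => by
          refine (le_fibR _ a b).trans (((A.tensor B).le_rres _ _ _).trans
            (Iff.trans ?_ (B.le_rres _ _ _).symm))
          rw [ract_tmul]
          exact (le_fibR _ _ _).symm
      map_ract := fun s x => RightHom.ext <| funext fun a => congrArg OrderDual.toDual <|
        eq_of_forall_le_iff (α := B) fun b => by
          refine (le_fibR _ a b).trans (((A.tensor B).le_lres _ _ _).trans
            (Iff.trans ?_ (le_fibR _ _ _).symm))
          rw [lact_tmul] }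
    (fun f => OrderDual.toDual (ofRightHom f))
    (fun s => congrArg OrderDual.toDual <| tensor_eq_of_tmul_le fun a b =>
      TensorSet.pure_le.trans (le_fibR (A := A) (B := B) (OrderDual.ofDual s) a b))
    (fun f => RightHom.ext <| funext fun a => congrArg OrderDual.toDual <|
      eq_of_forall_le_iff (α := B) fun b =>
        (le_fibR (A := A) (B := B) (ofRightHom f) a b).trans TensorSet.pure_le)

/-- `(A ⊗_Y B)° ≅ YMod(B, A°)` -/
def tensorOpIsoL (A : LocBimod X Y) (B : LocBimod Y Z) : (A.tensor B).op ≅ homL B A.op :=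
  isoOfInverse
    { toFun := fun s => toLeftHom (A := A) (B := B) (OrderDual.ofDual s)
      sup := SupPres.of_apply_le fun S (f : LeftHom B A.op) => by
        have key : ∀ b, OrderDual.ofDual (α := A) (f.toFun b) ≤
            fibL (sInf (OrderDual.toDual ⁻¹' S) : A.tensor B) b ↔
            ∀ s ∈ S, OrderDual.ofDual (α := A) (f.toFun b) ≤
              fibL (OrderDual.ofDual s : A.tensor B) b := fun b => by
          simp only [le_fibL, tmul_le_sInf]
          exact Iff.rfl
        exact ⟨fun H s hs b => (key b).1 (H b) s hs, fun H b => (key b).2 fun s hs => H s hs b⟩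
      map_lact := fun z s => LeftHom.ext <| funext fun b => congrArg OrderDual.toDual <|
        eq_of_forall_le_iff (α := A) fun a => by
          refine (le_fibL _ a b).trans (((A.tensor B).le_rres _ _ _).trans
            (Iff.trans ?_ (le_fibL _ _ _).symm))
          rw [ract_tmul]
      map_ract := fun s x => LeftHom.ext <| funext fun b => congrArg OrderDual.toDual <|
        eq_of_forall_le_iff (α := A) fun a => by
          refine (le_fibL _ a b).trans (((A.tensor B).le_lres _ _ _).trans
            (Iff.trans ?_ (A.le_lres _ _ _).symm))
          rw [lact_tmul]
          exact (le_fibL _ _ _).symm }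
    (fun f => OrderDual.toDual (ofLeftHom f))
    (fun s => congrArg OrderDual.toDual <| tensor_eq_of_tmul_le fun a b =>
      TensorSet.pure_le.trans (le_fibL (A := A) (B := B) (OrderDual.ofDual s) a b))
    (fun f => LeftHom.ext <| funext fun b => congrArg OrderDual.toDual <|
      eq_of_forall_le_iff (α := A) fun a =>
        (le_fibL (A := A) (B := B) (ofLeftHom f) a b).trans TensorSet.pure_le)

/-- `A ⊕ B = (B° ⊗ A°)° ≅ YMod(A°, B°°) ≅ YMod(A°, B)` -/
def parIsoL (A : LocBimod X Y) (B : LocBimod Y Z) : A.par B ≅ homL A.op B :=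
  tensorOpIsoL B.op A.op ≪≫ homLIso A.op (opOpIso B)

/-- `A ⊕ B = (B° ⊗ A°)° ≅ ModY(B°, A°°) ≅ ModY(B°, A)` -/
def parIsoR (A : LocBimod X Y) (B : LocBimod Y Z) : A.par B ≅ homR B.op A :=
  tensorOpIsoR B.op A.op ≪≫ homRIso B.op (opOpIso A)

/-! ### The linear distributions -/

/-- `A ⊗_Y ZMod(B, C) ⟶ ZMod(ModY(A, B), C)`, the transpose of the evaluation maps
`(ModY(A, B) ⊗_X A) ⊗_Y ZMod(B, C) ⟶ B ⊗_Y ZMod(B, C) ⟶ C`: it sends `a ⊗ g` to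
`h ↦ g (h a)`. -/
def evL (A : LocBimod X Y) (B : LocBimod Z Y) (C : LocBimod Z W) :
    A.tensor (homL B C) ⟶ homL (homR A B) C :=
  tensorLift (A := A) (B := homL B C) (C := homL (homR A B) C)
    (fun (a : A) (g : LeftHom B C) =>
      (⟨fun h : RightHom A B => g.toFun (h.toFun a),
        SupPres.of_apply_le fun S c => by
          refine (g.sup.gc _ c).trans ((RightHom.sSup_apply_le S a _).trans ?_)
          exact forall₂_congr fun h _ => (g.sup.gc _ c).symm,
        fun z h => g.map_lact z _⟩ : LeftHom (homR A B) C))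
    ⟨fun g => SupPres.of_apply_le fun S (k : LeftHom (homR A B) C) =>
        have key (h : RightHom A B) := ((LeftHom.sup g).comp h.sup).apply_le S (k.toFun h)
        ⟨fun H a ha h => (key h).1 (H h) a ha, fun H h => (key h).2 fun a ha => H a ha h⟩,
      fun a => SupPres.of_apply_le fun S (k : LeftHom (homR A B) C) =>
        have key (h : RightHom A B) := LeftHom.sSup_apply_le S (h.toFun a) (k.toFun h)
        ⟨fun H g hg h => (key h).1 (H h) g hg, fun H h => (key h).2 fun g hg => H g hg h⟩,
      fun a y g => LeftHom.ext <| funext fun h =>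
        congrArg (LeftHom.toFun g) (RightHom.map_ract h a y)⟩
    (fun x a g => rfl)
    (fun a g w => rfl)

/-- `ModY(B, A) ⊗_Z C ⟶ ModY(ZMod(C, B), A)`, the transpose of the evaluation maps
`ModY(B, A) ⊗_Z (C ⊗_W ZMod(C, B)) ⟶ ModY(B, A) ⊗_Z B ⟶ A`: it sends `f ⊗ c` to
`h ↦ f (h c)`. -/
def evR (A : LocBimod X Y) (B : LocBimod Z Y) (C : LocBimod Z W) :
    (homR B A).tensor C ⟶ homR (homL C B) A :=
  tensorLift (A := homR B A) (B := C) (C := homR (homL C B) A)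
    (fun (f : RightHom B A) (c : C) =>
      (⟨fun h : LeftHom C B => f.toFun (h.toFun c),
        SupPres.of_apply_le fun S a => by
          refine (f.sup.gc _ a).trans ((LeftHom.sSup_apply_le S c _).trans ?_)
          exact forall₂_congr fun h _ => (f.sup.gc _ a).symm,
        fun h y => f.map_ract _ y⟩ : RightHom (homL C B) A))
    ⟨fun c => SupPres.of_apply_le fun S (k : RightHom (homL C B) A) =>
        have key (h : LeftHom C B) := RightHom.sSup_apply_le S (h.toFun c) (k.toFun h)
        ⟨fun H f hf h => (key h).1 (H h) f hf, fun H h => (key h).2 fun f hf => H f hf h⟩,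
      fun f => SupPres.of_apply_le fun S (k : RightHom (homL C B) A) =>
        have key (h : LeftHom C B) := ((RightHom.sup f).comp h.sup).apply_le S (k.toFun h)
        ⟨fun H c hc h => (key h).1 (H h) c hc, fun H h => (key h).2 fun c hc => H c hc h⟩,
      fun f z c => RightHom.ext <| funext fun h =>
        (congrArg (RightHom.toFun f) (LeftHom.map_lact h z c)).symm⟩
    (fun x f c => rfl)
    (fun f c w => rfl)

/-- `A ⊗ (B ⊕ C) ≅ A ⊗_Y ZMod(B°, C) ⟶ ZMod(ModY(A, B°), C) ≅ ZMod((A ⊗ B)°, C) ≅ (A ⊗ B) ⊕ C` -/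
def distL (A : LocBimod X Y) (B : LocBimod Y Z) (C : LocBimod Z W) :
    A.tensor (B.par C) ⟶ (A.tensor B).par C :=
  tensorMap (𝟙 A) (parIsoL B C).hom ≫ evL A B.op C ≫ homLMap (tensorOpIsoR A B).hom (𝟙 C) ≫
    (parIsoL (A.tensor B) C).inv

/-- `(A ⊕ B) ⊗ C ≅ ModY(B°, A) ⊗_Z C ⟶ ModY(ZMod(C, B°), A) ≅ ModY((B ⊗ C)°, A) ≅ A ⊕ (B ⊗ C)` -/
def distR (A : LocBimod X Y) (B : LocBimod Y Z) (C : LocBimod Z W) :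
    (A.par B).tensor C ⟶ A.par (B.tensor C) :=
  tensorMap (parIsoR A B).hom (𝟙 C) ≫ evR A B.op C ≫ homRMap (tensorOpIsoL B C).hom (𝟙 A) ≫
    (parIsoR A (B.tensor C)).inv

end

end LocBimod

/-! ## The linear bicategory of locales -/

open LocBimod

/-- Locales, bimodules and bimodule homomorphisms, with the composition `A ⊗ B = A ⊗_Y B` and the
identity 1-cells `X`. -/
def locTensorData : BicategoryData Locale.{u} (fun X Y => LocBimod X Y) where
  comp A B := tensor A B
  unit X := LocBimod.unit X
  whiskerLeft A _ _ g := tensorMap (𝟙 A) g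
  whiskerRight f B := tensorMap f (𝟙 B)
  assoc := tensorAssoc
  leftUnitor := tensorLeftUnitor
  rightUnitor := tensorRightUnitor

/-- Locales, bimodules and bimodule homomorphisms, with the composition `A ⊕ B = (B° ⊗ A°)°` and
the identity 1-cells `X°`. -/
def locParData : BicategoryData Locale.{u} (fun X Y => LocBimod X Y) where
  comp A B := par A B
  unit X := (LocBimod.unit X).op
  whiskerLeft A _ _ g := parMap (𝟙 A) g
  whiskerRight f B := parMap f (𝟙 B)
  assoc := parAssoc
  leftUnitor := parLeftUnitor
  rightUnitor := parRightUnitor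

/-- Both compositions on locales, bimodules and bimodule homomorphisms, with the linear
distributions induced by evaluation. -/
def locLinearData : LinearBicategoryData Locale.{u} (fun X Y => LocBimod X Y) where
  tensor := locTensorData
  par := locParData
  distL := LocBimod.distL
  distR := LocBimod.distR

namespace LocBimod

open TensorSet

section

variable {X Y Z W V : Type u} [Order.Frame X] [Order.Frame Y] [Order.Frame Z] [Order.Frame W]
  [Order.Frame V]

/-! ### Extensionality for iterated tensor products -/

/-! The two compositions have opposite presentations. Every element of `A ⊗ B` is a supremum of
elements `a ⊗ b`, so a homomorphism out of a tensor product is determined by its values on these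
generators. Every element of `A ⊕ B = (B° ⊗ A°)°` is an infimum of elements `a ⊕ b` (`pmul`), so a
homomorphism into `A ⊕ B` is determined by its right adjoint on these cogenerators. The coherence of
`⊗` is thus a computation on generators. For `⊕` the same method applies to right adjoints: they
send cogenerators to cogenerators (`adj_parMap`, `adj_parAssoc_hom`, `adj_parLeftUnitor_hom`,
`adj_parRightUnitor_hom`), and the order of composition is reversed.

A distribution goes from a tensor to a par, so it is determined by which generators lie below which
cogenerators. For `s` in `A ⊗ B`, let `fibR s a` be the largest `b` with `a ⊗ b ≤ s`; this is `s`
read as a module homomorphism `A → B°`. Unwinding the evaluation maps gives `δ^L (a ⊗ p) ≤ s ⊕ c ↔ p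
≤ fibR s a ⊕ c` (`distL_tmul_le`), and symmetrically `δ^R (p ⊗ c) ≤ a ⊕ s ↔ p ≤ a ⊕ fibL s c`
(`distR_tmul_le`).

These two equivalences carry everything about the distributions. Naturality and the unit and
associativity conditions reduce to how `fibR` and `fibL` interact with right adjoints of the
structure maps. On `A ⊗ (B ⊕ C) ⊗ D`, both composites amount to the single condition `p ≤ fibR s a ⊕
fibL t e`. On `(A ⊕ B) ⊗ (C ⊕ D)`, both amount to `a' ⊗ c' ≤ s`, where `a'` and `c'` are the
smallest elements with `p ≤ a ⊕ a'` and `q ≤ c' ⊕ e`.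

Finally, the identity and the zero map of the unit bimodule of a nontrivial locale are different. -/

theorem tensor_hom_ext₃ {A : LocBimod X Y} {B : LocBimod Y Z} {C : LocBimod Z W}
    {D : LocBimod X W} {f g : (A.tensor B).tensor C ⟶ D}
    (h : ∀ a b c, f.toFun (tmul (tmul a b) c) = g.toFun (tmul (tmul a b) c)) : f = g :=
  tensor_hom_ext fun s c => tensor_ext (f.sup.comp ((bilin_tmul (A.tensor B) C).left c))
    (g.sup.comp ((bilin_tmul (A.tensor B) C).left c)) (fun a b => h a b c) s

theorem tensor_hom_ext₄ {A : LocBimod X Y} {B : LocBimod Y Z} {C : LocBimod Z W}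
    {E : LocBimod W V} {D : LocBimod X V} {f g : ((A.tensor B).tensor C).tensor E ⟶ D}
    (h : ∀ a b c e, f.toFun (tmul (tmul (tmul a b) c) e) =
      g.toFun (tmul (tmul (tmul a b) c) e)) : f = g :=
  -- The triple case is used with `A ⊗ B` as its first factor, which leaves only `s` in `A ⊗ B` to
  -- be reduced to generators.
  tensor_hom_ext₃ fun s c e =>
    have hs := ((bilin_tmul ((A.tensor B).tensor C) E).left e).comp
      ((bilin_tmul (A.tensor B) C).left c)
    tensor_ext (f.sup.comp hs) (g.sup.comp hs) (fun a b => h a b c e) s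

@[simp] theorem tensorAssoc_hom_tmul (A : LocBimod X Y) (B : LocBimod Y Z) (C : LocBimod Z W)
    (a : A) (b : B) (c : C) :
    Hom.toFun (tensorAssoc A B C).hom (tmul (tmul a b) c) = tmul a (tmul b c) :=
  tensorAssocHom_tmul A B C a b c

@[simp] theorem tensorLeftUnitor_inv_apply (A : LocBimod X Y) (a : A) :
    Hom.toFun (tensorLeftUnitor A).inv a = tmul (unitTop X) a := rfl

@[simp] theorem tensorRightUnitor_inv_apply (A : LocBimod X Y) (a : A) :
    Hom.toFun (tensorRightUnitor A).inv a = tmul a (unitTop Y) := rfl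

@[simp] theorem tensorLeftUnitor_hom_tmul_unitTop (A : LocBimod X Y) (a : A) :
    Hom.toFun (tensorLeftUnitor A).hom (tmul (unitTop X) a) = a :=
  (tensorLeftUnitorHom_tmul A _ a).trans (A.lact_top a)

@[simp] theorem tensorRightUnitor_hom_tmul_unitTop (A : LocBimod X Y) (a : A) :
    Hom.toFun (tensorRightUnitor A).hom (tmul a (unitTop Y)) = a :=
  (tensorRightUnitorHom_tmul A a _).trans (A.ract_top a)

/-! ### Coherence of `⊗` -/

theorem tensorAssoc_natural {A A' : LocBimod X Y} {B B' : LocBimod Y Z} {C C' : LocBimod Z W}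
    (f : A ⟶ A') (g : B ⟶ B') (h : C ⟶ C') :
    tensorMap (tensorMap f g) h ≫ (tensorAssoc A' B' C').hom =
      (tensorAssoc A B C).hom ≫ tensorMap f (tensorMap g h) :=
  tensor_hom_ext₃ fun a b c => by simp

/-- The inverse unitor `a ↦ ⊤ ⊗ a` has an explicit formula at every element, so naturality in this
form needs no generators. -/
theorem tensorLeftUnitor_natural {A A' : LocBimod X Y} (f : A ⟶ A') :
    (tensorLeftUnitor A).inv ≫ tensorMap (𝟙 (unit X)) f = f ≫ (tensorLeftUnitor A').inv :=
  hom_ext fun a => by simp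

theorem tensorRightUnitor_natural {A A' : LocBimod X Y} (f : A ⟶ A') :
    (tensorRightUnitor A).inv ≫ tensorMap f (𝟙 (unit Y)) = f ≫ (tensorRightUnitor A').inv :=
  hom_ext fun a => by simp

theorem tensor_pentagon (A : LocBimod X Y) (B : LocBimod Y Z) (C : LocBimod Z W)
    (E : LocBimod W V) :
    tensorMap (tensorAssoc A B C).hom (𝟙 E) ≫ (tensorAssoc A (B.tensor C) E).hom ≫
        tensorMap (𝟙 A) (tensorAssoc B C E).hom =
      (tensorAssoc (A.tensor B) C E).hom ≫ (tensorAssoc A B (C.tensor E)).hom :=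
  tensor_hom_ext₄ fun a b c e => by simp

theorem tensor_triangle (A : LocBimod X Y) (B : LocBimod Y Z) :
    (tensorAssoc A (unit Y) B).hom ≫ tensorMap (𝟙 A) (tensorLeftUnitor B).hom =
      tensorMap (tensorRightUnitor A).hom (𝟙 B) :=
  tensor_hom_ext₃ fun a y b => by
    rw [comp_toFun, tensorAssoc_hom_tmul, tensorMap_tmul, tensorMap_tmul]
    -- The triangle is the balancing relation `a ⊗ y b = a y ⊗ b`.
    refine (congrArg (tmul a) (tensorLeftUnitorHom_tmul B y b)).trans
      (((bilin_tmul A B).balanced a y b).symm.trans ?_)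
    exact congrArg (fun a' => tmul a' b) (tensorRightUnitorHom_tmul A a y).symm

theorem tensorMap_id_unit {A A' : LocBimod X Y} (f : A ⟶ A') :
    tensorMap (𝟙 (unit X)) f = (tensorLeftUnitor A).hom ≫ f ≫ (tensorLeftUnitor A').inv := by
  rw [← Iso.inv_comp_eq, tensorLeftUnitor_natural]

theorem tensorMap_unit_id {A A' : LocBimod X Y} (f : A ⟶ A') :
    tensorMap f (𝟙 (unit Y)) = (tensorRightUnitor A).hom ≫ f ≫ (tensorRightUnitor A').inv := by
  rw [← Iso.inv_comp_eq, tensorRightUnitor_natural]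

theorem tensorMap_id_tensor (A : LocBimod X Y) (B : LocBimod Y Z) {C C' : LocBimod Z W}
    (f : C ⟶ C') :
    tensorMap (𝟙 (A.tensor B)) f =
      (tensorAssoc A B C).hom ≫ tensorMap (𝟙 A) (tensorMap (𝟙 B) f) ≫ (tensorAssoc A B C').inv := by
  rw [← Category.assoc, Iso.eq_comp_inv, ← tensorMap_id, tensorAssoc_natural]

theorem tensorMap_tensor_id {A A' : LocBimod X Y} (f : A ⟶ A') (B : LocBimod Y Z)
    (C : LocBimod Z W) :
    tensorMap f (𝟙 (B.tensor C)) =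
      (tensorAssoc A B C).inv ≫ tensorMap (tensorMap f (𝟙 B)) (𝟙 C) ≫ (tensorAssoc A' B C).hom := by
  rw [Iso.eq_inv_comp, ← tensorMap_id, tensorAssoc_natural]

theorem tensorMap_tensorMap_id (A : LocBimod X Y) {B B' : LocBimod Y Z} (f : B ⟶ B')
    (C : LocBimod Z W) :
    tensorMap (tensorMap (𝟙 A) f) (𝟙 C) =
      (tensorAssoc A B C).hom ≫ tensorMap (𝟙 A) (tensorMap f (𝟙 C)) ≫ (tensorAssoc A B' C).inv := by
  rw [← Category.assoc, Iso.eq_comp_inv, tensorAssoc_natural]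

theorem tensorMap_exchange {A A' : LocBimod X Y} {B B' : LocBimod Y Z} (f : A ⟶ A')
    (g : B ⟶ B') : tensorMap (𝟙 A) g ≫ tensorMap f (𝟙 B') = tensorMap f (𝟙 B) ≫ tensorMap (𝟙 A') g := by
  rw [← tensorMap_comp, ← tensorMap_comp, Category.id_comp, Category.comp_id, Category.id_comp,
    Category.comp_id]

/-! ### Right adjoints of bimodule homomorphisms -/

@[simp] theorem adj_id (A : LocBimod X Y) (a : A) : Hom.adj (𝟙 A) a = a :=
  eq_of_forall_le_iff fun _ => le_adj (𝟙 A) _ _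

@[simp] theorem adj_comp {A B C : LocBimod X Y} (f : A ⟶ B) (g : B ⟶ C) (c : C) :
    Hom.adj (f ≫ g) c = Hom.adj f (Hom.adj g c) :=
  eq_of_forall_le_iff fun a => by simp only [le_adj, comp_toFun]

/-- A right adjoint determines its left adjoint. This serves when the target is not presented as a
par, as for the unitors of `⊕`. -/
theorem hom_ext_adj {A B : LocBimod X Y} {f g : A ⟶ B}
    (h : ∀ b, Hom.adj (A := A) (B := B) f b = Hom.adj (A := A) (B := B) g b) : f = g :=
  hom_ext fun a => eq_of_forall_ge_iff fun b => by rw [← le_adj, ← le_adj, h]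

/-- Dualising exchanges a map with its right adjoint, and doing so twice returns the map. Hence
right adjoints of the structure maps of `⊕`, which are opposites of maps between tensors, are
computed by those maps themselves. -/
theorem adj_opMap {A B : LocBimod X Y} (f : A ⟶ B) (a : A) :
    Hom.adj (opMap f) (OrderDual.toDual a : A.op) = (OrderDual.toDual (f.toFun a) : B.op) :=
  eq_of_forall_le_iff fun b =>
    (le_adj (opMap f) b (OrderDual.toDual a : A.op)).trans
      (le_adj f a (OrderDual.ofDual (α := B) b))

theorem adj_opOpIso_hom (A : LocBimod X Y) (a : A) :
    Hom.adj (opOpIso A).hom a = (OrderDual.toDual (OrderDual.toDual a) : A.op.op) :=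
  eq_of_forall_le_iff fun b => le_adj (opOpIso A).hom b a

/-! ### Cogenerators of `A ⊕ B` -/

/-- The element `a ⊕ b` of `A ⊕ B`. -/
def pmul {A : LocBimod X Y} {B : LocBimod Y Z} (a : A) (b : B) : A.par B :=
  (OrderDual.toDual (tmul (OrderDual.toDual b : B.op) (OrderDual.toDual a : A.op)) :
    (B.op.tensor A.op).op)

section

variable {A A' : LocBimod X Y} {B B' : LocBimod Y Z} {C : LocBimod Z W} {E : LocBimod W V}

/-- The elements `a ⊕ b` are meet-dense in `A ⊕ B`. -/
theorem par_eq_of_le_pmul {p q : A.par B} (h : ∀ a b, p ≤ pmul a b ↔ q ≤ pmul a b) : p = q :=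
  tensor_eq_of_tmul_le (A := B.op) (B := A.op) fun b a => h a b

theorem par_hom_ext {M : LocBimod X Z} {f g : M ⟶ A.par B}
    (h : ∀ a b, Hom.adj f (pmul a b) = Hom.adj g (pmul a b)) : f = g :=
  hom_ext fun m => par_eq_of_le_pmul fun a b => by rw [← le_adj, ← le_adj, h]

/-- The smallest `b` with `p ≤ a ⊕ b`. -/
def cofibR (p : A.par B) (a : A) : B :=
  LeftHom.toFun (A := A.op) (C := B) ((parIsoL A B).hom.toFun p) (OrderDual.toDual a)

/-- The smallest `a` with `p ≤ a ⊕ b`. -/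
def cofibL (p : A.par B) (b : B) : A :=
  RightHom.toFun (A := B.op) (B := A) ((parIsoR A B).hom.toFun p) (OrderDual.toDual b)

theorem cofibR_le {p : A.par B} {a : A} {b : B} : cofibR p a ≤ b ↔ p ≤ pmul a b :=
  le_fibL (A := B.op) (B := A.op) _ (OrderDual.toDual b) (OrderDual.toDual a)

theorem cofibL_le {p : A.par B} {a : A} {b : B} : cofibL p b ≤ a ↔ p ≤ pmul a b :=
  le_fibR (A := B.op) (B := A.op) _ (OrderDual.toDual b) (OrderDual.toDual a)

/-- Tests an element of `A ⊕ B` given as a module homomorphism against cogenerators: that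
homomorphism sends `a` to the smallest `b` with the element below `a ⊕ b`. -/
theorem parIsoL_inv_le {g : homL A.op B} {a : A} {b : B} :
    (parIsoL A B).inv.toFun g ≤ pmul a b ↔
      LeftHom.toFun (A := A.op) (C := B) g (OrderDual.toDual a) ≤ b := by
  rw [← cofibR_le, cofibR, ← comp_toFun, Iso.inv_hom_id, id_toFun]

theorem parIsoR_inv_le {g : homR B.op A} {a : A} {b : B} :
    (parIsoR A B).inv.toFun g ≤ pmul a b ↔
      RightHom.toFun (A := B.op) (B := A) g (OrderDual.toDual b) ≤ a := by
  rw [← cofibL_le, cofibL, ← comp_toFun, Iso.inv_hom_id, id_toFun]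

/-- For fixed `a`, the condition `p ≤ a ⊕ q` says that `cofibR p a ≤ q`, and the element `cofibR p
a` of `B ⊕ C` is determined by the cogenerators above it. So right-nested cogenerators suffice for
iterated pars. -/
theorem le_pmul_par_iff {p p' : A.par (B.par C)} {a : A}
    (h : ∀ b c, p ≤ pmul a (pmul b c) ↔ p' ≤ pmul a (pmul b c)) (q : B.par C) :
    p ≤ pmul a q ↔ p' ≤ pmul a q := by
  have e : cofibR p a = cofibR p' a :=
    par_eq_of_le_pmul fun b c => by rw [cofibR_le, cofibR_le, h]
  rw [← cofibR_le, ← cofibR_le, e]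

theorem par_hom_ext₃ {M : LocBimod X W} {f g : M ⟶ A.par (B.par C)}
    (h : ∀ a b c, Hom.adj f (pmul a (pmul b c)) = Hom.adj g (pmul a (pmul b c))) : f = g :=
  hom_ext fun m => par_eq_of_le_pmul fun a => le_pmul_par_iff fun b c => by
    rw [← le_adj, ← le_adj, h]

theorem par_hom_ext₄ {M : LocBimod X V} {f g : M ⟶ A.par (B.par (C.par E))}
    (h : ∀ a b c e, Hom.adj f (pmul a (pmul b (pmul c e))) =
      Hom.adj g (pmul a (pmul b (pmul c e)))) : f = g :=
  -- The triple case has `C ⊕ E` as its last factor. Moving `a` to the other side by `cofibR` leaves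
  -- a comparison in `B ⊕ (C ⊕ E)`, where `q` is reduced to the cogenerators `c ⊕ e`.
  par_hom_ext₃ fun a b q => eq_of_forall_le_iff fun m => by
    simp only [le_adj, ← cofibR_le (a := a)]
    exact le_pmul_par_iff (fun c e => by simp only [cofibR_le, ← le_adj, h]) q

@[simp] theorem adj_parMap (f : A ⟶ A') (g : B ⟶ B') (a : A') (b : B') :
    Hom.adj (parMap f g) (pmul a b) = pmul (Hom.adj f a) (Hom.adj g b) :=
  (adj_opMap (tensorMap (opMap g) (opMap f)) _).trans
    (congrArg OrderDual.toDual (tensorMap_tmul (opMap g) (opMap f) _ _))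

end

/-! ### Structure maps and coherence of `⊕` -/

-- The associator is the opposite of the inverse of a composite of three isomorphisms. Its right
-- adjoint is therefore that inverse: it removes a double dual, reassociates, and inserts a double
-- dual. `h₁`, `h₂` and `h₃` are these three steps on a generator.
@[simp] theorem adj_parAssoc_hom (A : LocBimod X Y) (B : LocBimod Y Z) (C : LocBimod Z W)
    (a : A) (b : B) (c : C) :
    Hom.adj (parAssoc A B C).hom (pmul a (pmul b c)) = pmul (pmul a b) c := by
  refine (adj_opMap _ _).trans (congrArg OrderDual.toDual ?_)
  have h₁ := tensorMap_tmul (opOpIso (C.op.tensor B.op)).hom (𝟙 A.op)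
    (OrderDual.toDual (pmul b c)) (OrderDual.toDual a)
  have h₂ := tensorAssoc_hom_tmul C.op B.op A.op (OrderDual.toDual c) (OrderDual.toDual b)
    (OrderDual.toDual a)
  have h₃ := tensorMap_tmul (𝟙 C.op) (opOpIso (B.op.tensor A.op)).inv (OrderDual.toDual c)
    (tmul (OrderDual.toDual b) (OrderDual.toDual a))
  refine Eq.trans ?_ h₃
  refine congrArg (tensorMap (𝟙 C.op) (opOpIso (B.op.tensor A.op)).inv).toFun ?_
  exact (congrArg (tensorAssoc C.op B.op A.op).hom.toFun h₁).trans h₂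

/-- The unit of `⊕`, as an element of the bimodule `X°`. -/
def unitBot (X : Type u) [Order.Frame X] : (unit X).op := OrderDual.toDual (unitTop X)

-- The two factors of the unitor dualise to `a ↦ a°°` and to the inverse unitor `a ↦ a ⊗ ⊤` of `A°`.
-- The formula holds at every `a`, so the triangle for `⊕` needs no balancing argument.
@[simp] theorem adj_parLeftUnitor_hom (A : LocBimod X Y) (a : A) :
    Hom.adj (parLeftUnitor A).hom a = pmul (unitBot X) a := by
  refine (adj_comp _ _ a).trans ((congrArg _ (adj_opOpIso_hom A a)).trans
    ((adj_opMap _ _).trans (congrArg OrderDual.toDual ?_)))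
  exact tensorMap_tmul (𝟙 A.op) (opOpIso (unit X)).inv _ _

@[simp] theorem adj_parRightUnitor_hom (A : LocBimod X Y) (a : A) :
    Hom.adj (parRightUnitor A).hom a = pmul a (unitBot Y) := by
  refine (adj_comp _ _ a).trans ((congrArg _ (adj_opOpIso_hom A a)).trans
    ((adj_opMap _ _).trans (congrArg OrderDual.toDual ?_)))
  exact tensorMap_tmul (opOpIso (unit Y)).inv (𝟙 A.op) _ _

theorem parMap_id (A : LocBimod X Y) (B : LocBimod Y Z) : parMap (𝟙 A) (𝟙 B) = 𝟙 (A.par B) :=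
  par_hom_ext fun a b => by simp

theorem parMap_comp {A A' A'' : LocBimod X Y} {B B' B'' : LocBimod Y Z} (f : A ⟶ A')
    (f' : A' ⟶ A'') (g : B ⟶ B') (g' : B' ⟶ B'') :
    parMap (f ≫ f') (g ≫ g') = parMap f g ≫ parMap f' g' :=
  par_hom_ext fun a b => by simp

theorem parAssoc_natural {A A' : LocBimod X Y} {B B' : LocBimod Y Z} {C C' : LocBimod Z W}
    (f : A ⟶ A') (g : B ⟶ B') (h : C ⟶ C') :
    parMap (parMap f g) h ≫ (parAssoc A' B' C').hom =
      (parAssoc A B C).hom ≫ parMap f (parMap g h) :=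
  par_hom_ext₃ fun a b c => by simp

theorem parLeftUnitor_natural {A A' : LocBimod X Y} (f : A ⟶ A') :
    parMap (𝟙 (unit X).op) f ≫ (parLeftUnitor A').hom = (parLeftUnitor A).hom ≫ f :=
  hom_ext_adj fun a => by simp

theorem parRightUnitor_natural {A A' : LocBimod X Y} (f : A ⟶ A') :
    parMap f (𝟙 (unit Y).op) ≫ (parRightUnitor A').hom = (parRightUnitor A).hom ≫ f :=
  hom_ext_adj fun a => by simp

theorem par_pentagon (A : LocBimod X Y) (B : LocBimod Y Z) (C : LocBimod Z W)
    (E : LocBimod W V) :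
    parMap (parAssoc A B C).hom (𝟙 E) ≫ (parAssoc A (B.par C) E).hom ≫
        parMap (𝟙 A) (parAssoc B C E).hom =
      (parAssoc (A.par B) C E).hom ≫ (parAssoc A B (C.par E)).hom :=
  par_hom_ext₄ fun a b c e => by simp

theorem par_triangle (A : LocBimod X Y) (B : LocBimod Y Z) :
    (parAssoc A (unit Y).op B).hom ≫ parMap (𝟙 A) (parLeftUnitor B).hom =
      parMap (parRightUnitor A).hom (𝟙 B) :=
  par_hom_ext fun a b => by simp

theorem parMap_id_unit {A A' : LocBimod X Y} (f : A ⟶ A') :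
    parMap (𝟙 (unit X).op) f = (parLeftUnitor A).hom ≫ f ≫ (parLeftUnitor A').inv := by
  rw [← Category.assoc, Iso.eq_comp_inv, parLeftUnitor_natural]

theorem parMap_unit_id {A A' : LocBimod X Y} (f : A ⟶ A') :
    parMap f (𝟙 (unit Y).op) = (parRightUnitor A).hom ≫ f ≫ (parRightUnitor A').inv := by
  rw [← Category.assoc, Iso.eq_comp_inv, parRightUnitor_natural]

theorem parMap_id_par (A : LocBimod X Y) (B : LocBimod Y Z) {C C' : LocBimod Z W}
    (f : C ⟶ C') :
    parMap (𝟙 (A.par B)) f =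
      (parAssoc A B C).hom ≫ parMap (𝟙 A) (parMap (𝟙 B) f) ≫ (parAssoc A B C').inv := by
  rw [← Category.assoc, Iso.eq_comp_inv, ← parMap_id, parAssoc_natural]

theorem parMap_par_id {A A' : LocBimod X Y} (f : A ⟶ A') (B : LocBimod Y Z)
    (C : LocBimod Z W) :
    parMap f (𝟙 (B.par C)) =
      (parAssoc A B C).inv ≫ parMap (parMap f (𝟙 B)) (𝟙 C) ≫ (parAssoc A' B C).hom := by
  rw [Iso.eq_inv_comp, ← parMap_id, parAssoc_natural]

theorem parMap_parMap_id (A : LocBimod X Y) {B B' : LocBimod Y Z} (f : B ⟶ B')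
    (C : LocBimod Z W) :
    parMap (parMap (𝟙 A) f) (𝟙 C) =
      (parAssoc A B C).hom ≫ parMap (𝟙 A) (parMap f (𝟙 C)) ≫ (parAssoc A B' C).inv := by
  rw [← Category.assoc, Iso.eq_comp_inv, parAssoc_natural]

theorem parMap_exchange {A A' : LocBimod X Y} {B B' : LocBimod Y Z} (f : A ⟶ A')
    (g : B ⟶ B') : parMap (𝟙 A) g ≫ parMap f (𝟙 B') = parMap f (𝟙 B) ≫ parMap (𝟙 A') g := by
  rw [← parMap_comp, ← parMap_comp, Category.id_comp, Category.comp_id, Category.id_comp,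
    Category.comp_id]

/-! ### The linear distributions on generators and cogenerators -/

section

variable {A A' : LocBimod X Y} {B B' : LocBimod Y Z} {C : LocBimod Z W}

theorem evL_tmul (A : LocBimod X Y) (B : LocBimod Z Y) (C : LocBimod Z W) (a : A)
    (g : LeftHom B C) (h : RightHom A B) :
    LeftHom.toFun (A := homR A B) (C := C) ((evL A B C).toFun (tmul (B := homL B C) a g)) h =
      g.toFun (h.toFun a) :=
  congrArg (fun k : LeftHom (homR A B) C => k.toFun h)
    (tensorLift_tmul (A := A) (B := homL B C) (C := homL (homR A B) C) _ _ _ _ a g)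

theorem evR_tmul (A : LocBimod X Y) (B : LocBimod Z Y) (C : LocBimod Z W) (f : RightHom B A)
    (c : C) (h : LeftHom C B) :
    RightHom.toFun (A := homL C B) (B := A) ((evR A B C).toFun (tmul (A := homR B A) f c)) h =
      f.toFun (h.toFun c) :=
  congrArg (fun k : RightHom (homL C B) A => k.toFun h)
    (tensorLift_tmul (A := homR B A) (B := C) (C := homR (homL C B) A) _ _ _ _ f c)

/-- View `p` as `g : B° → C` and `s` as `h : A → B°`. Then `δ^L (a ⊗ p)`, as a homomorphism on `(A ⊗
B)°`, takes the value `g (h a)` at `s`, where `h a` is `fibR s a`. Both sides of the equivalence say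
that `g (h a) ≤ c`. -/
theorem distL_tmul_le {a : A} {p : B.par C} {s : A.tensor B} {c : C} :
    (distL A B C).toFun (tmul a p) ≤ pmul s c ↔ p ≤ pmul (fibR s a) c := by
  have h₁ : (tensorMap (𝟙 A) (parIsoL B C).hom).toFun (tmul a p) =
      tmul a ((parIsoL B C).hom.toFun p) := tensorMap_tmul ..
  simp only [distL, comp_toFun, h₁]
  refine parIsoL_inv_le.trans (Iff.trans (iff_of_eq (congrArg (· ≤ c) ?_)) cofibR_le)
  -- The right module homomorphism attached to `s` has value `fibR s a` at `a` by definition, so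
  -- evaluation gives `cofibR p (fibR s a)`.
  exact evL_tmul A B.op C a _ ((tensorOpIsoR A B).hom.toFun (OrderDual.toDual s))

theorem distR_tmul_le {p : A.par B} {c : C} {a : A} {s : B.tensor C} :
    (distR A B C).toFun (tmul p c) ≤ pmul a s ↔ p ≤ pmul a (fibL s c) := by
  have h₁ : (tensorMap (parIsoR A B).hom (𝟙 C)).toFun (tmul p c) =
      tmul ((parIsoR A B).hom.toFun p) c := tensorMap_tmul ..
  simp only [distR, comp_toFun, h₁]
  refine parIsoR_inv_le.trans (Iff.trans (iff_of_eq (congrArg (· ≤ a) ?_)) cofibL_le)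
  exact evR_tmul A B.op C _ c ((tensorOpIsoL B C).hom.toFun (OrderDual.toDual s))

end

/-! ### Fibres of elements pulled back along right adjoints -/

/-- Restates `distL_tmul_le` as an equality, for the associativity of `⊕`: there a cogenerator is
first pulled back along one distribution and its fibre is then taken by another. -/
theorem fibR_adj_distL (A : LocBimod X Y) (B : LocBimod Y Z) (C : LocBimod Z W) (a : A)
    (s : A.tensor B) (c : C) :
    fibR (Hom.adj (distL A B C) (pmul s c)) a = pmul (fibR s a) c :=
  eq_of_forall_le_iff fun p => by rw [le_fibR, le_adj, distL_tmul_le]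

theorem fibL_adj_distR (A : LocBimod X Y) (B : LocBimod Y Z) (C : LocBimod Z W) (a : A)
    (s : B.tensor C) (c : C) :
    fibL (Hom.adj (distR A B C) (pmul a s)) c = pmul a (fibL s c) :=
  eq_of_forall_le_iff fun p => by rw [le_fibL, le_adj, distR_tmul_le]

theorem fibR_adj_tensorMap {A A' : LocBimod X Y} {B B' : LocBimod Y Z} (f : A ⟶ A') (g : B ⟶ B')
    (s : A'.tensor B') (a : A) :
    fibR (Hom.adj (tensorMap f g) s) a = Hom.adj g (fibR s (f.toFun a)) :=
  eq_of_forall_le_iff fun b => by rw [le_fibR, le_adj, le_adj, le_fibR, tensorMap_tmul]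

theorem fibL_adj_tensorMap {A A' : LocBimod X Y} {B B' : LocBimod Y Z} (f : A ⟶ A') (g : B ⟶ B')
    (s : A'.tensor B') (b : B) :
    fibL (Hom.adj (tensorMap f g) s) b = Hom.adj f (fibL s (g.toFun b)) :=
  eq_of_forall_le_iff fun a => by rw [le_fibL, le_adj, le_adj, le_fibL, tensorMap_tmul]

theorem fibR_adj_tensorAssoc (A : LocBimod X Y) (B : LocBimod Y Z) (C : LocBimod Z W)
    (s : A.tensor (B.tensor C)) (a : A) (b : B) :
    fibR (Hom.adj (tensorAssoc A B C).hom s) (tmul a b) = fibR (fibR s a) b :=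
  eq_of_forall_le_iff fun c => by
    rw [le_fibR, le_adj, le_fibR, le_fibR, tensorAssoc_hom_tmul]

/-- Currying: both sides are the largest `a` with `a ⊗ (b ⊗ c) ≤ s`. -/
theorem fibL_fibL (A : LocBimod X Y) (B : LocBimod Y Z) (C : LocBimod Z W)
    (s : A.tensor (B.tensor C)) (b : B) (c : C) :
    fibL (fibL (Hom.adj (tensorAssoc A B C).hom s) c) b = fibL s (tmul b c) :=
  eq_of_forall_le_iff fun a => by
    rw [le_fibL, le_fibL, le_adj, le_fibL, tensorAssoc_hom_tmul]

theorem fibR_adj_tensorLeftUnitor (A : LocBimod X Y) (a : A) :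
    fibR (Hom.adj (tensorLeftUnitor A).hom a) (unitTop X) = a :=
  eq_of_forall_le_iff fun b => by rw [le_fibR, le_adj, tensorLeftUnitor_hom_tmul_unitTop]

theorem fibL_adj_tensorRightUnitor (A : LocBimod X Y) (a : A) :
    fibL (Hom.adj (tensorRightUnitor A).hom a) (unitTop Y) = a :=
  eq_of_forall_le_iff fun b => by rw [le_fibL, le_adj, tensorRightUnitor_hom_tmul_unitTop]

/-- Homomorphisms `A ⊗ B ⟶ C ⊕ D` are equal if they agree up to the order on generators and
cogenerators. -/
theorem tensor_par_hom_ext {A : LocBimod X Y} {B : LocBimod Y Z} {C : LocBimod X W}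
    {D : LocBimod W Z} {f g : A.tensor B ⟶ C.par D}
    (h : ∀ a b c d, f.toFun (tmul a b) ≤ pmul c d ↔ g.toFun (tmul a b) ≤ pmul c d) : f = g :=
  tensor_hom_ext fun a b => par_eq_of_le_pmul fun c d => h a b c d

/-! ### Naturality of the distributions and the unit conditions -/

theorem distL_natural {A A' : LocBimod X Y} {B B' : LocBimod Y Z} {C C' : LocBimod Z W}
    (f : A ⟶ A') (g : B ⟶ B') (h : C ⟶ C') :
    tensorMap f (parMap g h) ≫ distL A' B' C' = distL A B C ≫ parMap (tensorMap f g) h :=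
  tensor_par_hom_ext fun a p s c => by
    rw [comp_toFun, comp_toFun, tensorMap_tmul, distL_tmul_le, ← le_adj, ← le_adj, adj_parMap,
      adj_parMap, distL_tmul_le, fibR_adj_tensorMap]

theorem distR_natural {A A' : LocBimod X Y} {B B' : LocBimod Y Z} {C C' : LocBimod Z W}
    (f : A ⟶ A') (g : B ⟶ B') (h : C ⟶ C') :
    tensorMap (parMap f g) h ≫ distR A' B' C' = distR A B C ≫ parMap f (tensorMap g h) :=
  tensor_par_hom_ext fun p c a s => by
    rw [comp_toFun, comp_toFun, tensorMap_tmul, distR_tmul_le, ← le_adj, ← le_adj, adj_parMap,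
      adj_parMap, distR_tmul_le, fibL_adj_tensorMap]

theorem distL_unit (A : LocBimod X Y) (B : LocBimod Y Z) :
    distL (unit X) A B ≫ parMap (tensorLeftUnitor A).hom (𝟙 B) =
      (tensorLeftUnitor (A.par B)).hom := by
  -- Composing with the inverse unitor replaces the generators `x ⊗ p` by the elements `⊤ ⊗ p`
  -- alone, and `fibR` at `⊤` undoes the right adjoint of the unitor.
  rw [← Iso.inv_comp_eq_id]
  refine hom_ext fun p => par_eq_of_le_pmul fun a b => ?_
  rw [comp_toFun, comp_toFun, tensorLeftUnitor_inv_apply, ← le_adj, adj_parMap, distL_tmul_le,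
    fibR_adj_tensorLeftUnitor, adj_id, id_toFun]

theorem distR_unit (A : LocBimod X Y) (B : LocBimod Y Z) :
    distR A B (unit Z) ≫ parMap (𝟙 A) (tensorRightUnitor B).hom =
      (tensorRightUnitor (A.par B)).hom := by
  rw [← Iso.inv_comp_eq_id]
  refine hom_ext fun p => par_eq_of_le_pmul fun a b => ?_
  rw [comp_toFun, comp_toFun, tensorRightUnitor_inv_apply, ← le_adj, adj_parMap, distR_tmul_le,
    fibL_adj_tensorRightUnitor, adj_id, id_toFun]

theorem distL_unit_op (A : LocBimod X Y) (B : LocBimod Y Z) :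
    distL A B (unit Z).op ≫ (parRightUnitor (A.tensor B)).hom =
      tensorMap (𝟙 A) (parRightUnitor B).hom :=
  tensor_hom_ext fun a p => eq_of_forall_ge_iff fun s => by
    rw [comp_toFun, ← le_adj, adj_parRightUnitor_hom, distL_tmul_le, tensorMap_tmul, id_toFun,
      ← le_fibR, ← le_adj, adj_parRightUnitor_hom]

theorem distR_unit_op (A : LocBimod X Y) (B : LocBimod Y Z) :
    distR (unit X).op A B ≫ (parLeftUnitor (A.tensor B)).hom =
      tensorMap (parLeftUnitor A).hom (𝟙 B) :=
  tensor_hom_ext fun p b => eq_of_forall_ge_iff fun s => by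
    rw [comp_toFun, ← le_adj, adj_parLeftUnitor_hom, distR_tmul_le, tensorMap_tmul, id_toFun,
      ← le_fibL, ← le_adj, adj_parLeftUnitor_hom]

/-! ### Distributions and associativity -/

theorem distL_tensorAssoc (A : LocBimod X Y) (B : LocBimod Y Z) (C : LocBimod Z W)
    (E : LocBimod W V) :
    distL (A.tensor B) C E ≫ parMap (tensorAssoc A B C).hom (𝟙 E) =
      (tensorAssoc A B (C.par E)).hom ≫ tensorMap (𝟙 A) (distL B C E) ≫
        distL A (B.tensor C) E :=
  tensor_hom_ext₃ fun a b p => par_eq_of_le_pmul fun s e => by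
    simp only [comp_toFun, tensorAssoc_hom_tmul, tensorMap_tmul, id_toFun, distL_tmul_le]
    -- Two distributions take the fibre of `s` at `a` and then at `b`; one distribution over `A ⊗ B`
    -- takes it at `a ⊗ b` at once.
    rw [← le_adj, adj_parMap, distL_tmul_le, adj_id, fibR_adj_tensorAssoc]

theorem distR_tensorAssoc (A : LocBimod X Y) (B : LocBimod Y Z) (C : LocBimod Z W)
    (E : LocBimod W V) :
    (tensorAssoc (A.par B) C E).hom ≫ distR A B (C.tensor E) =
      tensorMap (distR A B C) (𝟙 E) ≫ distR A (B.tensor C) E ≫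
        parMap (𝟙 A) (tensorAssoc B C E).hom :=
  tensor_hom_ext₃ fun p c e => par_eq_of_le_pmul fun a s => by
    simp only [comp_toFun, tensorAssoc_hom_tmul, tensorMap_tmul, id_toFun, distR_tmul_le]
    rw [← le_adj (parMap _ _), adj_parMap, distR_tmul_le, distR_tmul_le, adj_id, fibL_fibL]

theorem distL_parAssoc (A : LocBimod X Y) (B : LocBimod Y Z) (C : LocBimod Z W)
    (E : LocBimod W V) :
    tensorMap (𝟙 A) (parAssoc B C E).hom ≫ distL A B (C.par E) =
      distL A (B.par C) E ≫ parMap (distL A B C) (𝟙 E) ≫ (parAssoc (A.tensor B) C E).hom :=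
  tensor_hom_ext fun a p => par_eq_of_le_pmul fun s => le_pmul_par_iff fun c e => by
    simp only [comp_toFun, tensorMap_tmul, id_toFun, distL_tmul_le]
    simp only [← le_adj, adj_parAssoc_hom, adj_parMap, adj_id]
    -- Both sides become `p ≤ (fibR s a ⊕ c) ⊕ e`.
    rw [le_adj, distL_tmul_le, fibR_adj_distL]

theorem distR_parAssoc (A : LocBimod X Y) (B : LocBimod Y Z) (C : LocBimod Z W)
    (E : LocBimod W V) :
    distR (A.par B) C E ≫ (parAssoc A B (C.tensor E)).hom =
      tensorMap (parAssoc A B C).hom (𝟙 E) ≫ distR A (B.par C) E ≫ parMap (𝟙 A) (distR B C E) :=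
  tensor_hom_ext fun p e => par_eq_of_le_pmul fun a => le_pmul_par_iff fun b s => by
    simp only [comp_toFun, tensorMap_tmul, id_toFun]
    rw [← le_adj, adj_parAssoc_hom, distR_tmul_le, ← le_adj (parMap _ _), adj_parMap,
      distR_tmul_le, fibL_adj_distR, adj_id, ← le_adj, adj_parAssoc_hom]

/-! ### Compatibility of the two distributions -/

theorem distL_distR (A : LocBimod X Y) (B : LocBimod Y Z) (C : LocBimod Z W)
    (E : LocBimod W V) :
    tensorMap (distL A B C) (𝟙 E) ≫ distR (A.tensor B) C E =
      (tensorAssoc A (B.par C) E).hom ≫ tensorMap (𝟙 A) (distR B C E) ≫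
        distL A B (C.tensor E) :=
  tensor_hom_ext₃ fun a p e => par_eq_of_le_pmul fun s t => by
    simp only [comp_toFun, tensorAssoc_hom_tmul, tensorMap_tmul, id_toFun, distL_tmul_le,
      distR_tmul_le]

theorem distR_distL (A : LocBimod X Y) (B : LocBimod Y Z) (C : LocBimod Z W)
    (E : LocBimod W V) :
    distL (A.par B) C E ≫ parMap (distR A B C) (𝟙 E) ≫ (parAssoc A (B.tensor C) E).hom =
      distR A B (C.par E) ≫ parMap (𝟙 A) (distL B C E) :=
  tensor_hom_ext fun p q => par_eq_of_le_pmul fun a => le_pmul_par_iff fun s e => by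
    simp only [comp_toFun]
    -- One composite yields a condition on `q`, the other a condition on `p`. Alternating the
    -- adjunctions for fibres and cofibres brings both to `cofibR p a ⊗ cofibL q e ≤ s`.
    rw [← le_adj, adj_parAssoc_hom, ← le_adj, adj_parMap, distL_tmul_le, ← le_adj, adj_parMap,
      distR_tmul_le, adj_id, adj_id, ← cofibL_le, le_fibR, le_adj, distR_tmul_le, ← cofibR_le,
      le_fibL, ← cofibR_le, le_fibL, le_adj, distL_tmul_le, ← cofibL_le, le_fibR]

/-! ### Distinct parallel homomorphisms -/

/-- The zero homomorphism. -/
def zeroHom (A B : LocBimod X Y) : A ⟶ B where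
  toFun _ := ⊥
  sup := SupPres.of_apply_le fun S b => by simp
  map_lact x _ := le_antisymm bot_le (((B.lact_sup x).gc ⊥ ⊥).2 bot_le)
  map_ract _ y := le_antisymm bot_le (((B.sup_ract y).gc ⊥ ⊥).2 bot_le)

theorem id_ne_zeroHom_unit (X : Type u) [Order.Frame X] [Nontrivial X] :
    𝟙 (unit X) ≠ zeroHom (unit X) (unit X) := fun h =>
  top_ne_bot (α := X) (congrFun (congrArg Hom.toFun h) (⊤ : X))

end

end LocBimod

/-! ### The two bicategory structures and the linear bicategory -/

theorem locTensorData_isBicategory : locTensorData.{u}.IsBicategory where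
  whiskerLeft_id A B := tensorMap_id A B
  whiskerLeft_comp A _ _ _ f g := tensorMap_comp (𝟙 A) (𝟙 A) f g
  id_whiskerLeft f := tensorMap_id_unit f
  comp_whiskerLeft A B _ _ f := tensorMap_id_tensor A B f
  id_whiskerRight A B := tensorMap_id A B
  comp_whiskerRight f g B := tensorMap_comp f g (𝟙 B) (𝟙 B)
  whiskerRight_id f := tensorMap_unit_id f
  whiskerRight_comp f B C := tensorMap_tensor_id f B C
  whisker_assoc A _ _ f C := tensorMap_tensorMap_id A f C
  whisker_exchange f g := tensorMap_exchange f g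
  pentagon A B C E := tensor_pentagon A B C E
  triangle A B := tensor_triangle A B

theorem locParData_isBicategory : locParData.{u}.IsBicategory where
  whiskerLeft_id A B := parMap_id A B
  whiskerLeft_comp A _ _ _ f g := parMap_comp (𝟙 A) (𝟙 A) f g
  id_whiskerLeft f := parMap_id_unit f
  comp_whiskerLeft A B _ _ f := parMap_id_par A B f
  id_whiskerRight A B := parMap_id A B
  comp_whiskerRight f g B := parMap_comp f g (𝟙 B) (𝟙 B)
  whiskerRight_id f := parMap_unit_id f
  whiskerRight_comp f B C := parMap_par_id f B C
  whisker_assoc A _ _ f C := parMap_parMap_id A f C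
  whisker_exchange f g := parMap_exchange f g
  pentagon A B C E := par_pentagon A B C E
  triangle A B := par_triangle A B

theorem locLinearData_isLinearBicategory : locLinearData.{u}.IsLinearBicategory where
  tensor_isBicategory := locTensorData_isBicategory
  par_isBicategory := locParData_isBicategory
  distL_natural₁ f B C := by
    have h := distL_natural f (𝟙 B) (𝟙 C)
    -- Whiskering by `B ⊕ C` uses the identity of the par, whereas the joint naturality square has
    -- `𝟙 B ⊕ 𝟙 C`.
    rw [parMap_id] at h
    exact h
  distL_natural₂ A _ _ f C := distL_natural (𝟙 A) f (𝟙 C)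
  distL_natural₃ A B _ _ f := by
    have h := distL_natural (𝟙 A) (𝟙 B) f
    rw [tensorMap_id] at h
    exact h
  distR_natural₁ f B C := by
    have h := distR_natural f (𝟙 B) (𝟙 C)
    rw [tensorMap_id] at h
    exact h
  distR_natural₂ A _ _ f C := distR_natural (𝟙 A) f (𝟙 C)
  distR_natural₃ A B _ _ f := by
    have h := distR_natural (𝟙 A) (𝟙 B) f
    rw [parMap_id] at h
    exact h
  distL_top A B := distL_unit A B
  distL_bot A B := distL_unit_op A B
  distR_top A B := distR_unit A B
  distR_bot A B := distR_unit_op A B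
  distL_tensor_assoc A B C E := distL_tensorAssoc A B C E
  distR_tensor_assoc A B C E := distR_tensorAssoc A B C E
  distL_par_assoc A B C E := distL_parAssoc A B C E
  distR_par_assoc A B C E := distR_parAssoc A B C E
  distL_distR A B C E := LocBimod.distL_distR A B C E
  distR_distL A B C E := LocBimod.distR_distL A B C E

/-- Locales, bimodules and bimodule homomorphisms form a linear bicategory under `⊗` and `⊕`, which
is not locally posetal. -/
theorem mainTheorem9 :
    locLinearData.{u}.IsLinearBicategory ∧
      ∃ (X Y : Locale.{u}) (A B : LocBimod X Y) (f g : A ⟶ B), f ≠ g := by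
  refine ⟨locLinearData_isLinearBicategory, ?_⟩
  -- The locale of the one-point space, available in every universe; being nontrivial, it has `⊤ ≠
  -- ⊥`.
  let X : Locale.{u} := Locale.of (Set PUnit.{u + 1})
  have : Nontrivial X := inferInstanceAs (Nontrivial (Set PUnit.{u + 1}))
  exact ⟨X, X, LocBimod.unit X, LocBimod.unit X, 𝟙 _, zeroHom _ _, id_ne_zeroHom_unit X⟩
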